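/- Let $d\in\mathbb N$, $d\ge 1$, and $\rho>0$ with $d\neq 2\rho$. Let $(k,\ell)$ be of type $(\mathcal{PC})$: $k\in L_{1,loc}([0,\infty))$ is nonnegative and nonincreasing, $\ell\in L_{1,loc}([0,\infty))$, and $(k*\ell)(t)=\int_0^t k(t-s)\ell(s)\,ds=1$ in $(0,\infty)$ (as an identity in $L_{1,loc}$). Let $u_0\in L_1(\mathbb R^d)\cap L_2(\mathbb R^d)$. For $\tau\ge 0$ let $w(\cdot,\tau)$ be the propagation function, i.e. the unique nondecreasing, left-continuous function of bounded variation on $[0,\infty)$ with $w(0,\tau)=0$ and $$\int_0^\infty e^{-\lambda\sigma}w(\sigma,\tau)\,d\sigma=\frac1\lambda\exp\bigl(-\tau\lambda\widehat k(\lambda)\bigr),\quad \lambda>0,\qquad \widehat k(\lambda)=\int_0^\infty e^{-\lambda\sigma}k(\sigma)\,d\sigma ;$$ for $t>0$ the function $w(t,\cdot)$ is nonincreasing and right-continuous. For $\tau>0$ let $\eta^\rho_\tau(x)=(2\pi)^{-d}\int_{\mathbb R^d}e^{ix\cdot\xi}e^{-\tau|\xi|^\rho}\,d\xi$ be the kernel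 of the semigroup generated by $-(-\Delta)^{\rho/2}$, and for $t>0$ put $$Z(t,x)=-\int_0^\infty \eta^\rho_\tau(x)\,w(t,d\tau),\qquad u(t,x)=\int_{\mathbb R^d}Z(t,x-y)u_0(y)\,dy ,$$ so that $u$ is the mild solution of $\partial_t(k*[u-u_0])+(-\Delta)^{\rho/2}u=0$, $u(0,\cdot)=u_0$. Then for every $t>0$ these integrals converge absolutely for almost every $x$ and $u(t,\cdot)\in L_2(\mathbb R^d)$, and there is a constant $C>0$ such that, with $(1*\ell)(t)=\int_0^t\ell(s)\,ds$, $$\|u(t,\cdot)\|_{L_2(\mathbb R^d)}\le C\,\bigl[(1*\ell)(t)\bigr]^{-\min\{1,\,d/(2\rho)\}}\quad\text{for all } t>1 .$$ -/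

import Mathlib

noncomputable section

namespace NonlocalDiffusion

open MeasureTheory Set

/-- Convolution on the half-line: `(f * g)(t) = ∫₀ᵗ f(t - s) g(s) ds`. -/
def timeConv (f g : ℝ → ℝ) (t : ℝ) : ℝ :=
  ∫ s in (0 : ℝ)..t, f (t - s) * g s

/-- The pair `(k, ℓ)` is of type `(PC)`: `k ∈ L_{1,loc}([0,∞))` is nonnegative and nonincreasing,
`ℓ ∈ L_{1,loc}([0,∞))`, and `k * ℓ = 1` on `(0,∞)`, as an identity in `L_{1,loc}`, that is,
almost everywhere. -/
structure IsPC (k ℓ : ℝ → ℝ) : Prop where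
  locallyIntegrable_k : ∀ T : ℝ, 0 < T → IntegrableOn k (Ioc 0 T)
  nonneg_k : ∀ t : ℝ, 0 < t → 0 ≤ k t
  antitone_k : AntitoneOn k (Ioi 0)
  locallyIntegrable_l : ∀ T : ℝ, 0 < T → IntegrableOn ℓ (Ioc 0 T)
  conv_eq_one : ∀ᵐ t : ℝ ∂(volume.restrict (Ioi 0)), timeConv k ℓ t = 1

/-- The Laplace transform `∫₀^∞ e^{-pσ} f(σ) dσ`. -/
def laplace (f : ℝ → ℝ) (p : ℝ) : ℝ :=
  ∫ σ in Ioi (0 : ℝ), Real.exp (-(p * σ)) * f σ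

/-- `v = w(·, τ)` is the propagation function with parameter `τ`: it is nondecreasing and of
bounded variation on `[0,∞)`, left-continuous, normalized by `v(0) = 0`, and its Laplace transform
is `ψ_τ(p) / p` with `ψ_τ(p) = exp(-τ φ(p))` and `φ(p) = p k̂(p)`. These properties determine `v`
on `[0,∞)`. -/
structure IsPropagation (k : ℝ → ℝ) (τ : ℝ) (v : ℝ → ℝ) : Prop where
  mono : MonotoneOn v (Ici 0)
  bv : BoundedVariationOn v (Ici 0)
  zero : v 0 = 0
  leftCont : ∀ σ : ℝ, 0 < σ → ContinuousWithinAt v (Iic σ) σ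
  laplace_eq : ∀ p : ℝ, 0 < p → laplace v p = Real.exp (-(τ * (p * laplace k p))) / p

open Classical in
/-- The propagation function `w(t, τ)` of `k`. It exists (Bernstein's theorem) and is unique on
`[0,∞) × [0,∞)` for every `k` with `(k, ℓ)` of type `(PC)`; for other `k` the value is junk. -/
def propagation (k : ℝ → ℝ) : ℝ → ℝ → ℝ :=
  if h : ∃ w : ℝ → ℝ → ℝ, ∀ τ : ℝ, 0 ≤ τ → IsPropagation k τ (fun σ => w σ τ)
  then h.choose else 0

open Classical in
/-- The Lebesgue–Stieltjes measure `-w(t, dτ)` on `[0,∞)`. For `t > 0` the function `w(t, ·)` is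
nonincreasing and right-continuous on `[0,∞)`; it is extended constantly to the left of `0`, so
that no mass is created there. -/
def propagationMeasure (k : ℝ → ℝ) (t : ℝ) : Measure ℝ :=
  if h : Monotone (fun τ : ℝ => -propagation k t (max τ 0))
  then h.stieltjesFunction.measure else 0

/-- The density `η^ρ_τ`, `τ > 0`, of the convolution semigroup with symbol `|ξ|^ρ`, that is, the
function with `∫ e^{-i x·ξ} η^ρ_τ(x) dx = e^{-τ|ξ|^ρ}`:
`η^ρ_τ(x) = (2π)^{-d} ∫ e^{i x·ξ} e^{-τ|ξ|^ρ} dξ`. -/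
def eta (d : ℕ) (ρ τ : ℝ) (x : EuclideanSpace ℝ (Fin d)) : ℂ :=
  (((2 * Real.pi) ^ d : ℝ) : ℂ)⁻¹ *
    ∫ ξ : EuclideanSpace ℝ (Fin d),
      Complex.exp (Complex.I * ((inner ℝ x ξ : ℝ) : ℂ)) * ((Real.exp (-(τ * ‖ξ‖ ^ ρ)) : ℝ) : ℂ)

/-- The fundamental solution `Z(t, x) = -∫₀^∞ η^ρ_τ(x) w(t, dτ)`. -/
def fundamentalSolution (d : ℕ) (ρ : ℝ) (k : ℝ → ℝ) (t : ℝ) (x : EuclideanSpace ℝ (Fin d)) : ℂ :=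
  ∫ τ in Ioi (0 : ℝ), eta d ρ τ x ∂(propagationMeasure k t)

/-- The mild solution with `f = 0`: `u(t, x) = ∫ Z(t, x - y) u₀(y) dy`. -/
def mildSolution (d : ℕ) (ρ : ℝ) (k : ℝ → ℝ) (u₀ : EuclideanSpace ℝ (Fin d) → ℂ) (t : ℝ)
    (x : EuclideanSpace ℝ (Fin d)) : ℂ :=
  ∫ y : EuclideanSpace ℝ (Fin d), fundamentalSolution d ρ k t (x - y) * u₀ y

end NonlocalDiffusion

end

/-! On the Fourier side `(-Δ)^{ρ/2}` is multiplication by `q = ‖2πζ‖^ρ`, so the transform of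
`Z(t,·)` at `ζ` is `s(q) = ∫ e^{-qτ} (-w(t,dτ))`. Everything rests on the relaxation estimate `s(q)
≤ 1 / (1 + q (1*ℓ)(t))`, which is `IsPC.lintegral_exp_propagationMeasure_le`. Granted this,
Plancherel leaves the `L₂` norm of `|û₀| / (1 + q (1*ℓ)(t))`. If `d > 2ρ`, drop the `1`: `|û₀| / q`
is in `L₂`, because `û₀` is bounded near the origin and square integrable away from it; the rate is
`(1*ℓ)⁻¹`. If `d < 2ρ`, bound `|û₀|` by `‖u₀‖₁` and rescale `ζ`, which gives `(1*ℓ)^{-d/(2ρ)}`. At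
`d = 2ρ` the two weights just fail to be square integrable, at the origin and at infinity
respectively.

The relaxation estimate is proved by probability. `w(·,τ)` is the distribution function of `μ_τ`,
where `(μ_τ)` is a convolution semigroup of subprobability measures on `[0,∞)` with Laplace exponent
`p k̂(p)`. A sum of nonnegative numbers is below `t` only if both summands are, hence `w(t,a+b) ≤
w(t,a) w(t,b)`. Put `L = ∫ w(t,τ) dτ` and `A = ∫ e^{-qτ} w(t,τ) dτ`. Submultiplicativity gives `L ≤
A (1 + qL)` (`IsSubordinator.mean_le`), integration by parts gives `s + qA ≤ 1`, and together `s ≤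
1/(1+qL)`.

That `L = 1*ℓ` is `IsPC.timeConv_one_eq`: the Laplace transform of `L` is `1/(p² k̂(p))`, so `k*L =
1*1`; convolving with `ℓ` and using `k*ℓ = 1` gives `1*L = 1*(1*ℓ)`, and primitives determine
left-continuous functions.

Two constructions support this. The measures `μ_τ` are compound Poisson laws when `k` is bounded,
and limits of convolutions of such laws otherwise (`exists_mlap_of_isKernel`). The kernels `η^ρ_τ`
need not be positive for `ρ > 2`, so their uniform `L₁` bound comes from subordination to the
Schwartz symbols `exp(-s‖ξ‖^{2N})`. -/

noncomputable section

namespace NonlocalDiffusion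

open MeasureTheory Set Filter Topology
open scoped ENNReal NNReal FourierTransform SchwartzMap Convolution

/-! ### Laplace transforms and distribution functions of measures on `[0,∞)` -/

/-- The Laplace transform of a `[0,∞]`-valued function on `(0,∞)`. -/
def lap (f : ℝ → ℝ≥0∞) (p : ℝ) : ℝ≥0∞ :=
  ∫⁻ σ in Ioi (0 : ℝ), ENNReal.ofReal (Real.exp (-(p * σ))) * f σ

/-- The Laplace transform of a measure on `[0,∞)`. -/
def mlap (μ : Measure ℝ≥0) (p : ℝ) : ℝ≥0∞ :=
  ∫⁻ x : ℝ≥0, ENNReal.ofReal (Real.exp (-(p * x))) ∂μ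

/-- The left-continuous distribution function of a measure on `[0,∞)`. -/
def cdfLt (μ : Measure ℝ≥0) (t : ℝ) : ℝ≥0∞ := μ {x : ℝ≥0 | (x : ℝ) < t}

lemma measurable_exp_neg_mul (p : ℝ) :
    Measurable fun σ : ℝ => ENNReal.ofReal (Real.exp (-(p * σ))) := by fun_prop

lemma measurableSet_coe_lt (t : ℝ) : MeasurableSet {x : ℝ≥0 | (x : ℝ) < t} :=
  measurableSet_lt (by fun_prop) measurable_const

lemma cdfLt_mono (μ : Measure ℝ≥0) : Monotone (cdfLt μ) := fun _ _ hst =>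
  measure_mono fun _ hx => lt_of_lt_of_le hx hst

lemma cdfLt_of_nonpos (μ : Measure ℝ≥0) {t : ℝ} (ht : t ≤ 0) : cdfLt μ t = 0 := by
  have : {x : ℝ≥0 | (x : ℝ) < t} = ∅ := by
    ext x
    simp only [mem_ofPred_eq, mem_empty_iff_false, iff_false, not_lt]
    exact ht.trans x.2
  simp [cdfLt, this]

lemma tendsto_nhdsLT_of_le_iSup {f : ℝ → ℝ≥0∞} (hf : Monotone f) {t : ℝ} {u : ℕ → ℝ}
    (hu : ∀ n, u n < t) (h : f t ≤ ⨆ n, f (u n)) : Tendsto f (𝓝[<] t) (𝓝 (f t)) := by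
  have hsup : f t = sSup (f '' Iio t) := by
    refine le_antisymm (h.trans (iSup_le fun n => le_sSup ⟨u n, hu n, rfl⟩)) (sSup_le ?_)
    rintro _ ⟨s, hs, rfl⟩
    exact hf (le_of_lt hs)
  rw [hsup]
  exact hf.tendsto_nhdsLT t

lemma tendsto_measure_Iio {m : Measure ℝ} (t : ℝ) :
    Tendsto (fun s => m (Iio s)) (𝓝[<] t) (𝓝 (m (Iio t))) := by
  obtain ⟨u, hu, hut, hulim⟩ := exists_seq_strictMono_tendsto t
  refine tendsto_nhdsLT_of_le_iSup (fun _ _ h => measure_mono (Iio_subset_Iio h)) hut ?_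
  have hU : Iio t ⊆ ⋃ n, Iio (u n) := fun x hx =>
    mem_iUnion.2 (hulim.eventually_const_lt (mem_Iio.1 hx)).exists
  rw [← Monotone.measure_iUnion fun m n hmn => Iio_subset_Iio (hu.monotone hmn)]
  exact measure_mono hU

lemma cdfLt_eq_map (μ : Measure ℝ≥0) (t : ℝ) :
    cdfLt μ t = μ.map (fun x : ℝ≥0 => (x : ℝ)) (Iio t) := by
  rw [Measure.map_apply (by fun_prop) measurableSet_Iio]
  rfl

lemma tendsto_cdfLt (μ : Measure ℝ≥0) (t : ℝ) :
    Tendsto (cdfLt μ) (𝓝[<] t) (𝓝 (cdfLt μ t)) := by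
  have := tendsto_measure_Iio (m := μ.map (fun x : ℝ≥0 => (x : ℝ))) t
  simpa only [← cdfLt_eq_map] using this

lemma mlap_zero (μ : Measure ℝ≥0) : mlap μ 0 = μ univ := by simp [mlap]

lemma lap_congr {f g : ℝ → ℝ≥0∞} (h : ∀ᵐ t ∂(volume.restrict (Ioi (0 : ℝ))), f t = g t) (p : ℝ) :
    lap f p = lap g p :=
  lintegral_congr_ae (h.mono fun t ht => by simp only [ht])

lemma lintegral_exp_Ioi {p : ℝ} (hp : 0 < p) (c : ℝ) :
    ∫⁻ σ in Ioi c, ENNReal.ofReal (Real.exp (-(p * σ))) =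
      ENNReal.ofReal (Real.exp (-(p * c)) / p) := by
  have h1 := integrableOn_exp_mul_Ioi (neg_lt_zero.2 hp) c
  have h2 := integral_exp_mul_Ioi (neg_lt_zero.2 hp) c
  simp only [neg_mul] at h1 h2
  rw [← ofReal_integral_eq_lintegral_ofReal h1 (ae_of_all _ fun _ => (Real.exp_pos _).le), h2,
    neg_div_neg_eq]

lemma lap_one {p : ℝ} (hp : 0 < p) : lap (fun _ => 1) p = ENNReal.ofReal (1 / p) := by
  simp only [lap, mul_one]
  rw [lintegral_exp_Ioi hp]
  simp

/-- Integration by parts: `p ∫ e^{-pσ} μ[0,σ) dσ = ∫ e^{-px} dμ(x)`. -/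
lemma ofReal_mul_lap_cdfLt (μ : Measure ℝ≥0) [SFinite μ] {p : ℝ} (hp : 0 < p) :
    ENNReal.ofReal p * lap (cdfLt μ) p = mlap μ p := by
  have hm : Measurable (fun z : ℝ × ℝ≥0 => ENNReal.ofReal (Real.exp (-(p * z.1))) *
      indicator {y : ℝ × ℝ≥0 | (y.2 : ℝ) < y.1} (fun _ => (1 : ℝ≥0∞)) z) := by
    refine Measurable.mul (by fun_prop) (measurable_const.indicator ?_)
    exact measurableSet_lt (by fun_prop) (by fun_prop)
  have h1 : lap (cdfLt μ) p = ∫⁻ σ in Ioi (0 : ℝ), ∫⁻ x : ℝ≥0,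
      ENNReal.ofReal (Real.exp (-(p * σ))) *
      indicator {y : ℝ × ℝ≥0 | (y.2 : ℝ) < y.1} (fun _ => (1 : ℝ≥0∞)) (σ, x) ∂μ := by
    refine lintegral_congr fun σ => ?_
    rw [lintegral_const_mul]
    · congr 1
      rw [cdfLt, ← lintegral_indicator_one (measurableSet_coe_lt σ)]
      rfl
    · exact (measurable_const.indicator (measurableSet_coe_lt σ) :
        Measurable ({x : ℝ≥0 | (x : ℝ) < σ}.indicator fun _ => (1 : ℝ≥0∞)))
  rw [h1, lintegral_lintegral_swap hm.aemeasurable, mlap, ← lintegral_const_mul]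
  · refine lintegral_congr fun x => ?_
    have h2 : ∫⁻ σ in Ioi (0 : ℝ), ENNReal.ofReal (Real.exp (-(p * σ))) *
        indicator {y : ℝ × ℝ≥0 | (y.2 : ℝ) < y.1} (fun _ => (1 : ℝ≥0∞)) (σ, x) =
        ∫⁻ σ in Ioi (x : ℝ), ENNReal.ofReal (Real.exp (-(p * σ))) := by
      rw [← lintegral_indicator measurableSet_Ioi, ← lintegral_indicator measurableSet_Ioi]
      refine lintegral_congr fun σ => ?_
      by_cases h : (x : ℝ) < σ
      · have h0 : 0 < σ := lt_of_le_of_lt x.2 h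
        simp [indicator, h, h0]
      · simp [indicator, h]
    rw [h2, lintegral_exp_Ioi hp, ← ENNReal.ofReal_mul hp.le]
    congr 1
    field_simp
  · exact Measurable.lintegral_prod_left' hm

/-- A bounded nondecreasing function vanishing on `(-∞,0]` is almost everywhere the distribution
function of a finite measure on `[0,∞)`. -/
lemma exists_measure_cdfLt_eq {G : ℝ → ℝ} (hG : Monotone G) (h0 : ∀ t ≤ 0, G t = 0) {K : ℝ}
    (hK : ∀ t, G t ≤ K) :
    ∃ ν : Measure ℝ≥0, ν univ ≤ ENNReal.ofReal K ∧
      ∀ᵐ t : ℝ, cdfLt ν t = ENNReal.ofReal (G t) := by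
  set S := hG.stieltjesFunction with hS
  have hSle : ∀ t, S t ≤ G (t + 1) := fun t => by
    rw [hS, hG.stieltjesFunction_eq]
    exact hG.rightLim_le (by linarith)
  have hleS : ∀ t, G t ≤ S t := fun t => by
    rw [hS, hG.stieltjesFunction_eq]
    exact hG.le_rightLim le_rfl
  have hbot : Tendsto S atBot (𝓝 0) := by
    refine tendsto_const_nhds.congr' ?_
    filter_upwards [eventually_le_atBot (-1)] with t ht
    refine le_antisymm ?_ ?_
    · rw [← h0 t (by linarith)]; exact hleS t
    · rw [← h0 (t + 1) (by linarith)]; exact hSle t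
  have htop := tendsto_atTop_ciSup S.mono ⟨K, by rintro _ ⟨t, rfl⟩; exact (hSle t).trans (hK _)⟩
  have hsup : (⨆ t, S t) ≤ K := ciSup_le fun t => (hSle t).trans (hK _)
  refine ⟨S.measure.map Real.toNNReal, ?_, ?_⟩
  · rw [Measure.map_apply (by fun_prop) MeasurableSet.univ, preimage_univ,
      S.measure_univ hbot htop, sub_zero]
    exact ENNReal.ofReal_le_ofReal hsup
  -- The Stieltjes function is the right limit of `G`, so it can differ from `G` only on the
  -- countable set of discontinuities.
  · have hc : ∀ᵐ t : ℝ, ContinuousAt G t :=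
      (hG.countable_not_continuousAt.measure_zero volume : _)
    filter_upwards [hc] with t ht
    rcases le_or_gt t 0 with h | h
    · rw [cdfLt_of_nonpos _ h, h0 t h, ENNReal.ofReal_zero]
    have hpre : Real.toNNReal ⁻¹' {x : ℝ≥0 | (x : ℝ) < t} = Iio t := by
      ext y
      simp [Real.coe_toNNReal', h]
    rw [cdfLt, Measure.map_apply (by fun_prop) (measurableSet_coe_lt t), hpre,
      S.measure_Iio hbot, sub_zero]
    congr 1
    refine le_antisymm ?_ ?_
    · refine (S.mono.leftLim_le le_rfl).trans_eq ?_
      rw [hS, hG.stieltjesFunction_eq]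
      exact ht.continuousWithinAt.rightLim_eq
    · have hlim : Tendsto G (𝓝[<] t) (𝓝 (G t)) := ht.tendsto.mono_left nhdsWithin_le_nhds
      refine le_of_tendsto hlim ?_
      filter_upwards [self_mem_nhdsWithin] with s hs
      exact (hleS s).trans (S.mono.le_leftLim hs)

/-! ### Convolutions and compound Poisson laws -/

lemma mlap_conv (μ ν : Measure ℝ≥0) [SFinite ν] (p : ℝ) :
    mlap (μ.conv ν) p = mlap μ p * mlap ν p := by
  rw [mlap, Measure.lintegral_conv (by fun_prop), mlap, ← lintegral_mul_const _ (by fun_prop)]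
  refine lintegral_congr fun x => ?_
  rw [mlap, ← lintegral_const_mul _ (by fun_prop)]
  refine lintegral_congr fun y => ?_
  rw [← ENNReal.ofReal_mul (Real.exp_pos _).le, ← Real.exp_add]
  congr 2
  push_cast
  ring

lemma conv_univ_le_one {μ ν : Measure ℝ≥0} [SFinite ν] (hμ : μ univ ≤ 1) (hν : ν univ ≤ 1) :
    (μ.conv ν) univ ≤ 1 := by
  rw [← mlap_zero, mlap_conv, mlap_zero, mlap_zero]
  exact mul_le_one' hμ hν

/-- For `x, y ≥ 0` the condition `x + y < t` forces `x < t` and `y < t`. This is the source of the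
submultiplicativity of `w(t,·)`. -/
lemma cdfLt_conv_le_mul (μ ν : Measure ℝ≥0) [SFinite ν] (t : ℝ) :
    cdfLt (μ.conv ν) t ≤ cdfLt μ t * cdfLt ν t := by
  rw [cdfLt, ← lintegral_indicator_one (measurableSet_coe_lt t),
    Measure.lintegral_conv (measurable_one.indicator (measurableSet_coe_lt t)), cdfLt,
    ← lintegral_indicator_one (measurableSet_coe_lt t), cdfLt,
    ← lintegral_indicator_one (measurableSet_coe_lt t),
    ← lintegral_mul_const _ (measurable_one.indicator (measurableSet_coe_lt t))]
  refine lintegral_mono fun x => ?_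
  rw [← lintegral_const_mul _ (measurable_one.indicator (measurableSet_coe_lt t))]
  refine lintegral_mono fun y => ?_
  by_cases h : (x : ℝ) + y < t
  · have hx : (x : ℝ) < t := lt_of_le_of_lt (le_add_of_nonneg_right y.2) h
    have hy : (y : ℝ) < t := lt_of_le_of_lt (le_add_of_nonneg_left x.2) h
    simp [indicator, hx, hy, h]
  · simp [indicator, h]

lemma cdfLt_le_one {μ : Measure ℝ≥0} (hμ : μ univ ≤ 1) (t : ℝ) : cdfLt μ t ≤ 1 :=
  (measure_mono (subset_univ _)).trans hμ

lemma cdfLt_conv_le (μ ν : Measure ℝ≥0) [SFinite ν] (hν : ν univ ≤ 1) (t : ℝ) :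
    cdfLt (μ.conv ν) t ≤ cdfLt μ t :=
  (cdfLt_conv_le_mul μ ν t).trans (mul_le_of_le_one_right' (cdfLt_le_one hν t))

/-- Compound Poisson laws: if `ν` has mass at most `K`, then `exp(-τ (K - ν̂(p)))` is the Laplace
transform of a measure. -/
lemma exists_mlap_eq_exp (ν : Measure ℝ≥0) {K τ : ℝ} (hK : 0 ≤ K) (hν : ν univ ≤ ENNReal.ofReal K)
    (hτ : 0 ≤ τ) :
    ∃ μ : Measure ℝ≥0, μ univ ≤ 1 ∧
      ∀ p, 0 ≤ p → mlap μ p = ENNReal.ofReal (Real.exp (-(τ * (K - (mlap ν p).toReal)))) := by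
  have : IsFiniteMeasure ν := ⟨hν.trans_lt ENNReal.ofReal_lt_top⟩
  let pw : ℕ → Measure ℝ≥0 := fun n => Nat.rec (Measure.dirac 0) (fun _ m => m.conv ν) n
  have hpw : ∀ n p, mlap (pw n) p = mlap ν p ^ n := by
    intro n p
    induction n with
    | zero => simp [pw, mlap]
    | succ n ih => rw [pow_succ, ← ih, ← mlap_conv]
  have hle : ∀ p, 0 ≤ p → mlap ν p ≤ ν univ := fun p hp => by
    rw [← mlap_zero]
    refine lintegral_mono fun x => ENNReal.ofReal_le_ofReal (Real.exp_le_exp.2 ?_)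
    have : 0 ≤ p * (x : ℝ) := mul_nonneg hp x.2
    linarith
  -- The Poisson mixture `e^{-τK} Σ τⁿ/n! ν^{*n}`; its Laplace transform is the exponential series
  -- at `τ ν̂(p)`.
  let μ : Measure ℝ≥0 := Measure.sum fun n =>
    ENNReal.ofReal (Real.exp (-(τ * K)) * (τ ^ n / n.factorial)) • pw n
  have hμ : ∀ p, 0 ≤ p →
      mlap μ p = ENNReal.ofReal (Real.exp (-(τ * (K - (mlap ν p).toReal)))) := by
    intro p hp
    have hfin : mlap ν p ≠ ⊤ := ((hle p hp).trans_lt (measure_lt_top _ _)).ne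
    set a := (mlap ν p).toReal with ha
    have ha0 : 0 ≤ a := ENNReal.toReal_nonneg
    have hsum : HasSum (fun n : ℕ => Real.exp (-(τ * K)) * ((τ * a) ^ n / n.factorial))
        (Real.exp (-(τ * (K - a)))) := by
      have := (NormedSpace.expSeries_div_hasSum_exp (τ * a)).mul_left (Real.exp (-(τ * K)))
      rw [← Real.exp_eq_exp_ℝ, ← Real.exp_add] at this
      have he : -(τ * (K - a)) = -(τ * K) + τ * a := by ring
      rw [he]
      exact this
    rw [← hsum.tsum_eq, ENNReal.ofReal_tsum_of_nonneg (fun n => by positivity) hsum.summable,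
      mlap, lintegral_sum_measure]
    refine tsum_congr fun n => ?_
    rw [lintegral_smul_measure, ← mlap, hpw, ← ENNReal.ofReal_toReal hfin, ← ha, smul_eq_mul,
      ← ENNReal.ofReal_pow ha0, ← ENNReal.ofReal_mul (by positivity)]
    congr 1
    ring
  refine ⟨μ, ?_, hμ⟩
  -- The total mass is the transform at `p = 0`; it is below `1` when `ν` has mass less than `K` and
  -- `τ > 0`.
  rw [← mlap_zero, hμ 0 le_rfl, ← ENNReal.ofReal_one]
  refine ENNReal.ofReal_le_ofReal (Real.exp_le_one_iff.2 ?_)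
  rw [mlap_zero]
  have : (ν univ).toReal ≤ K := ENNReal.toReal_le_of_le_ofReal hK hν
  nlinarith

/-! ### Measures with Laplace transform `exp(-τ p k̂(p))` -/

/-- A nonnegative nonincreasing kernel on `(0,∞)` that is integrable near `0`. -/
structure IsKernel (k : ℝ → ℝ) : Prop where
  integrableOn : ∀ T : ℝ, 0 < T → IntegrableOn k (Ioc 0 T)
  nonneg : ∀ t : ℝ, 0 < t → 0 ≤ k t
  antitoneOn : AntitoneOn k (Ioi 0)

lemma IsPC.isKernel {k ℓ : ℝ → ℝ} (h : IsPC k ℓ) : IsKernel k :=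
  ⟨h.locallyIntegrable_k, h.nonneg_k, h.antitone_k⟩

lemma IsKernel.aemeasurable {k : ℝ → ℝ} (hk : IsKernel k) :
    AEMeasurable k (volume.restrict (Ioi 0)) :=
  aemeasurable_restrict_of_antitoneOn measurableSet_Ioi hk.antitoneOn

lemma integrableOn_exp_mul_of_le {f : ℝ → ℝ} {C p a : ℝ} (hp : 0 < p)
    (hf : AEStronglyMeasurable f (volume.restrict (Ioi a))) (hC : ∀ t, a < t → |f t| ≤ C) :
    IntegrableOn (fun σ => Real.exp (-(p * σ)) * f σ) (Ioi a) := by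
  have h1 := integrableOn_exp_mul_Ioi (neg_lt_zero.2 hp) a
  simp only [neg_mul] at h1
  refine Integrable.mul_bdd (c := C) h1 hf ?_
  filter_upwards [ae_restrict_mem measurableSet_Ioi] with t ht
  exact hC t ht

/-- Up to time `1` local integrability suffices; beyond it monotonicity bounds `k` by `k 1`, and the
exponential is integrable. -/
lemma IsKernel.integrableOn_exp_mul {k : ℝ → ℝ} (hk : IsKernel k) {p : ℝ} (hp : 0 < p) :
    IntegrableOn (fun σ => Real.exp (-(p * σ)) * k σ) (Ioi 0) := by
  rw [← Ioc_union_Ioi_eq_Ioi (zero_le_one' ℝ)]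
  refine IntegrableOn.union ?_ ?_
  · refine Integrable.bdd_mul (c := 1) (hk.integrableOn 1 one_pos) (by fun_prop) ?_
    filter_upwards [ae_restrict_mem measurableSet_Ioc] with t ht
    rw [Real.norm_eq_abs, Real.abs_exp, Real.exp_le_one_iff]
    nlinarith [ht.1]
  · refine integrableOn_exp_mul_of_le (C := k 1) hp ?_ fun t ht => ?_
    · exact (hk.aemeasurable.mono_set (Ioi_subset_Ioi zero_le_one)).aestronglyMeasurable
    · have h0 : (0 : ℝ) < t := one_pos.trans ht
      rw [abs_of_nonneg (hk.nonneg t h0)]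
      exact hk.antitoneOn (mem_Ioi.2 one_pos) (mem_Ioi.2 h0) ht.le

lemma IsKernel.laplace_nonneg {k : ℝ → ℝ} (hk : IsKernel k) (p : ℝ) : 0 ≤ laplace k p :=
  setIntegral_nonneg measurableSet_Ioi fun t ht => mul_nonneg (Real.exp_pos _).le (hk.nonneg t ht)

lemma lap_ofReal {f : ℝ → ℝ} {p : ℝ}
    (hf : IntegrableOn (fun σ => Real.exp (-(p * σ)) * f σ) (Ioi 0))
    (h0 : ∀ t, 0 < t → 0 ≤ f t) :
    lap (fun t => ENNReal.ofReal (f t)) p = ENNReal.ofReal (laplace f p) := by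
  rw [laplace, ofReal_integral_eq_lintegral_ofReal hf]
  · exact lintegral_congr fun t => (ENNReal.ofReal_mul (Real.exp_pos _).le).symm
  · filter_upwards [ae_restrict_mem measurableSet_Ioi] with t ht
    exact mul_nonneg (Real.exp_pos _).le (h0 t ht)

lemma laplace_const {p : ℝ} (hp : 0 < p) (c : ℝ) : laplace (fun _ => c) p = c / p := by
  have h2 := integral_exp_mul_Ioi (neg_lt_zero.2 hp) 0
  simp only [neg_mul] at h2
  rw [laplace, integral_mul_const, h2]
  simp
  field_simp

lemma laplace_sub {f g : ℝ → ℝ} {p : ℝ}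
    (hf : IntegrableOn (fun σ => Real.exp (-(p * σ)) * f σ) (Ioi 0))
    (hg : IntegrableOn (fun σ => Real.exp (-(p * σ)) * g σ) (Ioi 0)) :
    laplace (fun t => f t - g t) p = laplace f p - laplace g p := by
  simp only [laplace, mul_sub]
  exact integral_sub hf hg

lemma isKernel_of_bounded {f : ℝ → ℝ} {K : ℝ} (hf : AntitoneOn f (Ioi 0))
    (h0 : ∀ t, 0 < t → 0 ≤ f t) (hK : ∀ t, 0 < t → f t ≤ K) : IsKernel f := by
  refine ⟨fun T _ => ?_, h0, hf⟩
  refine Integrable.of_bound (C := K) ?_ ?_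
  · exact ((aemeasurable_restrict_of_antitoneOn measurableSet_Ioi hf).mono_set
      Ioc_subset_Ioi_self).aestronglyMeasurable
  · filter_upwards [ae_restrict_mem measurableSet_Ioc] with t ht
    rw [Real.norm_eq_abs, abs_of_nonneg (h0 t ht.1)]
    exact hK t ht.1

/-- For a bounded kernel `f`, `exp(-τ p f̂(p))` is the Laplace transform of a measure. -/
lemma exists_mlap_of_bounded {f : ℝ → ℝ} {K τ : ℝ} (hf : AntitoneOn f (Ioi 0))
    (h0 : ∀ t, 0 < t → 0 ≤ f t) (hK : ∀ t, 0 < t → f t ≤ K) (hτ : 0 ≤ τ) :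
    ∃ μ : Measure ℝ≥0, μ univ ≤ 1 ∧
      ∀ p, 0 < p → mlap μ p = ENNReal.ofReal (Real.exp (-(τ * (p * laplace f p)))) := by
  have hK0 : 0 ≤ K := (h0 1 one_pos).trans (hK 1 one_pos)
  -- `K - f` is bounded and nondecreasing, hence a.e. the distribution function of some `ν`.
  -- Integration by parts then gives `p f̂(p) = K - ν̂(p)`, a compound Poisson exponent.
  let G : ℝ → ℝ := fun t => if t ≤ 0 then 0 else K - f t
  have hG : Monotone G := by
    intro s t hst
    simp only [G]
    split_ifs with h1 h2 h2
    · exact le_rfl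
    · linarith [hK t (not_le.1 h2)]
    · exact absurd (hst.trans h2) h1
    · linarith [hf (mem_Ioi.2 (not_le.1 h1)) (mem_Ioi.2 (not_le.1 h2)) hst]
  obtain ⟨ν, hν, hcdf⟩ := exists_measure_cdfLt_eq hG (fun t ht => if_pos ht) (K := K) fun t => by
    simp only [G]
    split_ifs with h
    · exact hK0
    · linarith [h0 t (not_le.1 h)]
  have : IsFiniteMeasure ν := ⟨hν.trans_lt ENNReal.ofReal_lt_top⟩
  obtain ⟨μ, hμ1, hμ⟩ := exists_mlap_eq_exp ν hK0 hν hτ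
  refine ⟨μ, hμ1, fun p hp => ?_⟩
  rw [hμ p hp.le]
  have hker := (isKernel_of_bounded hf h0 hK).integrableOn_exp_mul hp
  have hconst : IntegrableOn (fun σ => Real.exp (-(p * σ)) * K) (Ioi 0) :=
    integrableOn_exp_mul_of_le (C := |K|) hp aestronglyMeasurable_const fun _ _ => le_rfl
  have hsub : IntegrableOn (fun σ => Real.exp (-(p * σ)) * (K - f σ)) (Ioi 0) := by
    simp only [mul_sub]
    exact hconst.sub hker
  have hl : laplace (fun t => K - f t) p = K / p - laplace f p := by
    rw [laplace_sub hconst hker, laplace_const hp]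
  have hl0 : 0 ≤ laplace (fun t => K - f t) p :=
    setIntegral_nonneg measurableSet_Ioi fun t ht =>
      mul_nonneg (Real.exp_pos _).le (by linarith [hK t ht])
  have h1 : mlap ν p = ENNReal.ofReal (p * laplace (fun t => K - f t) p) := by
    rw [← ofReal_mul_lap_cdfLt ν hp, ENNReal.ofReal_mul hp.le,
      ← lap_ofReal hsub fun t ht => by linarith [hK t ht]]
    congr 1
    refine lap_congr ?_ p
    filter_upwards [ae_restrict_of_ae hcdf, ae_restrict_mem measurableSet_Ioi] with t ht ht0
    rw [ht]
    simp only [G, if_neg (not_le.2 (mem_Ioi.1 ht0))]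
  rw [h1, ENNReal.toReal_ofReal (mul_nonneg hp.le hl0), hl]
  congr 3
  field_simp
  ring

/-- For a kernel `k`, `exp(-τ p k̂(p))` is the Laplace transform of a measure. -/
theorem exists_mlap_of_isKernel {k : ℝ → ℝ} (hk : IsKernel k) {τ : ℝ} (hτ : 0 ≤ τ) :
    ∃ μ : Measure ℝ≥0, μ univ ≤ 1 ∧
      ∀ p, 0 < p → mlap μ p = ENNReal.ofReal (Real.exp (-(τ * (p * laplace k p)))) := by
  let ε : ℕ → ℝ := fun n => 1 / ((n : ℝ) + 1)
  have hε : ∀ n, 0 < ε n := fun n => by positivity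
  have hεanti : ∀ n, ε (n + 1) ≤ ε n := fun n => by
    simp only [ε]
    push_cast
    gcongr
    linarith
  -- Capping `k` at its value at `ε n` makes it bounded; the capped kernels increase to `k` on
  -- `(0,∞)`.
  let f : ℕ → ℝ → ℝ := fun n t => k (max t (ε n))
  have hpos : ∀ n t, 0 < max t (ε n) := fun n t => lt_max_of_lt_right (hε n)
  have hf_anti : ∀ n, AntitoneOn (f n) (Ioi 0) := fun n s _ t _ hst =>
    hk.antitoneOn (hpos n s) (hpos n t) (max_le_max_right _ hst)
  have hf_nonneg : ∀ n t, 0 < t → 0 ≤ f n t := fun n t _ => hk.nonneg _ (hpos n t)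
  have hf_le : ∀ n t, 0 < t → f n t ≤ k (ε n) := fun n t _ =>
    hk.antitoneOn (hε n) (hpos n t) (le_max_right _ _)
  have hf_succ : ∀ n t, 0 < t → f n t ≤ f (n + 1) t := fun n t _ =>
    hk.antitoneOn (hpos (n + 1) t) (hpos n t) (max_le_max_left _ (hεanti n))
  have hf_int : ∀ n p, 0 < p → IntegrableOn (fun σ => Real.exp (-(p * σ)) * f n σ) (Ioi 0) :=
    fun n p hp => (isKernel_of_bounded (hf_anti n) (hf_nonneg n) (hf_le n)).integrableOn_exp_mul hp
  obtain ⟨μ0, hμ0, hμ0'⟩ := exists_mlap_of_bounded (hf_anti 0) (hf_nonneg 0) (hf_le 0) hτ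
  -- The increment `f (n+1) - f n` is again a bounded kernel: it is `f (n+1) - k (ε n)` up to `ε n`
  -- and zero afterwards. So passing from `n` to `n+1` is convolution with a subprobability measure,
  -- which makes the distribution functions decrease in `n`.
  have hstep : ∀ n, ∃ μ : Measure ℝ≥0, μ univ ≤ 1 ∧ ∀ p, 0 < p → mlap μ p =
      ENNReal.ofReal (Real.exp (-(τ * (p * laplace (fun t => f (n + 1) t - f n t) p)))) := by
    intro n
    refine exists_mlap_of_bounded (K := k (ε (n + 1))) ?_
      (fun t ht => sub_nonneg.2 (hf_succ n t ht)) (fun t ht => ?_) hτ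
    · intro s hs t ht hst
      simp only [f]
      rcases le_total t (ε n) with h | h
      · have hs' : s ≤ ε n := hst.trans h
        rw [max_eq_right h, max_eq_right hs']
        exact sub_le_sub_right (hf_anti (n + 1) hs ht hst) _
      · rw [max_eq_left h, max_eq_left ((hεanti n).trans h), sub_self]
        exact sub_nonneg.2 (hf_succ n s hs)
    · linarith [hf_le (n + 1) t ht, hf_nonneg n t ht]
  choose κ hκ1 hκ using hstep
  have hκs : ∀ n, IsFiniteMeasure (κ n) := fun n => ⟨(hκ1 n).trans_lt ENNReal.one_lt_top⟩
  obtain ⟨μ, hμ_zero, hμ_succ⟩ : ∃ μ : ℕ → Measure ℝ≥0, μ 0 = μ0 ∧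
      ∀ n, μ (n + 1) = (μ n).conv (κ n) :=
    ⟨fun n => Nat.rec μ0 (fun m ν => ν.conv (κ m)) n, rfl, fun _ => rfl⟩
  have hμ1 : ∀ n, μ n univ ≤ 1 := fun n => by
    induction n with
    | zero => rw [hμ_zero]; exact hμ0
    | succ n ih => rw [hμ_succ]; exact conv_univ_le_one ih (hκ1 n)
  have hμfin : ∀ n, IsFiniteMeasure (μ n) := fun n => ⟨(hμ1 n).trans_lt ENNReal.one_lt_top⟩
  have hμl : ∀ n p, 0 < p →
      mlap (μ n) p = ENNReal.ofReal (Real.exp (-(τ * (p * laplace (f n) p)))) := by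
    intro n p hp
    induction n with
    | zero => rw [hμ_zero]; exact hμ0' p hp
    | succ n ih =>
      rw [hμ_succ, mlap_conv, ih, hκ n p hp, ← ENNReal.ofReal_mul (Real.exp_pos _).le,
        ← Real.exp_add, laplace_sub (hf_int _ p hp) (hf_int _ p hp)]
      congr 2
      ring
  have hanti : Antitone fun n => cdfLt (μ n) := antitone_nat_of_succ_le fun n t => by
    rw [hμ_succ]
    exact cdfLt_conv_le _ _ (hκ1 n) t
  have hcdf1 : ∀ n t, cdfLt (μ n) t ≤ 1 := fun n t => cdfLt_le_one (hμ1 n) t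
  let v : ℝ → ℝ≥0∞ := fun t => ⨅ n, cdfLt (μ n) t
  have hv1 : ∀ t, v t ≤ 1 := fun t => (iInf_le _ 0).trans (hcdf1 0 t)
  have hvmono : Monotone v := fun s t hst => iInf_mono fun n => cdfLt_mono _ hst
  have hvfin : ∀ t, v t ≠ ⊤ := fun t => ((hv1 t).trans_lt ENNReal.one_lt_top).ne
  obtain ⟨ν, hν1, hν⟩ := exists_measure_cdfLt_eq (G := fun t => (v t).toReal) (K := 1)
    (fun s t hst => ENNReal.toReal_mono (hvfin t) (hvmono hst))
    (fun t ht => by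
      have : v t = 0 := le_antisymm ((iInf_le _ 0).trans (cdfLt_of_nonpos _ ht).le) zero_le
      simp [this])
    (fun t => ENNReal.toReal_le_of_le_ofReal zero_le_one (by simpa using hv1 t))
  have : IsFiniteMeasure ν := ⟨hν1.trans_lt ENNReal.ofReal_lt_top⟩
  refine ⟨ν, by simpa using hν1, fun p hp => ?_⟩
  have hlapv : mlap ν p = ⨅ n, mlap (μ n) p := by
    have h1 : lap (cdfLt ν) p = lap v p := by
      refine lap_congr ?_ p
      filter_upwards [ae_restrict_of_ae hν] with t ht
      rw [ht, ENNReal.ofReal_toReal (hvfin t)]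
    have h2 : lap v p = ⨅ n, lap (cdfLt (μ n)) p := by
      have : ∀ σ, ENNReal.ofReal (Real.exp (-(p * σ))) * v σ =
          ⨅ n, ENNReal.ofReal (Real.exp (-(p * σ))) * cdfLt (μ n) σ := fun σ =>
        ENNReal.mul_iInf_of_ne (ENNReal.ofReal_pos.2 (Real.exp_pos _)).ne' ENNReal.ofReal_ne_top
      simp only [lap, this]
      refine lintegral_iInf (fun n => ?_) (fun m n hmn σ => ?_) ?_
      · exact (measurable_exp_neg_mul p).mul (cdfLt_mono _).measurable
      · exact mul_le_mul_right (hanti hmn σ) _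
      -- Interchanging the infimum with the integral needs one finite member of the decreasing
      -- sequence.
      · refine ((lintegral_mono fun σ => mul_le_of_le_one_right' (hcdf1 0 σ)).trans_lt ?_).ne
        rw [lintegral_exp_Ioi hp]
        exact ENNReal.ofReal_lt_top
    rw [← ofReal_mul_lap_cdfLt ν hp, h1, h2,
      ENNReal.mul_iInf_of_ne (ENNReal.ofReal_pos.2 hp).ne' ENNReal.ofReal_ne_top]
    exact iInf_congr fun n => ofReal_mul_lap_cdfLt (μ n) hp
  have hmlanti : Antitone fun n => mlap (μ n) p := antitone_nat_of_succ_le fun n => by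
    rw [← ofReal_mul_lap_cdfLt (μ n) hp, ← ofReal_mul_lap_cdfLt (μ (n + 1)) hp]
    refine mul_le_mul_right (lintegral_mono fun σ => mul_le_mul_right (hanti n.le_succ σ) _) _
  have hlim1 : Tendsto (fun n => mlap (μ n) p) atTop (𝓝 (mlap ν p)) := by
    rw [hlapv]
    exact tendsto_atTop_iInf hmlanti
  have hlimk : Tendsto (fun n => laplace (f n) p) atTop (𝓝 (laplace k p)) := by
    refine tendsto_integral_of_dominated_convergence _ (fun n => (hf_int n p hp).1)
      (hk.integrableOn_exp_mul hp) (fun n => ?_) ?_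
    · filter_upwards [ae_restrict_mem measurableSet_Ioi] with t ht
      rw [Real.norm_eq_abs, abs_of_nonneg (mul_nonneg (Real.exp_pos _).le (hf_nonneg n t ht))]
      exact mul_le_mul_of_nonneg_left (hk.antitoneOn ht (hpos n t) (le_max_left _ _))
        (Real.exp_pos _).le
    · filter_upwards [ae_restrict_mem measurableSet_Ioi] with t ht
      refine tendsto_const_nhds.congr' ?_
      filter_upwards [(tendsto_one_div_add_atTop_nhds_zero_nat (𝕜 := ℝ)).eventually_lt_const
        (mem_Ioi.1 ht)] with n hn
      simp only [f, ε]
      rw [max_eq_left hn.le]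
  have hlim2 : Tendsto (fun n => mlap (μ n) p) atTop
      (𝓝 (ENNReal.ofReal (Real.exp (-(τ * (p * laplace k p)))))) := by
    simp only [hμl _ p hp]
    refine ENNReal.tendsto_ofReal ((Real.continuous_exp.tendsto _).comp ?_)
    exact ((hlimk.const_mul p).const_mul τ).neg
  exact tendsto_nhds_unique hlim1 hlim2

/-! ### Existence of the propagation function -/

/-- Existence of the propagation function of a kernel. -/
theorem exists_isPropagation {k : ℝ → ℝ} (hk : IsKernel k) :
    ∃ w : ℝ → ℝ → ℝ, ∀ τ : ℝ, 0 ≤ τ → IsPropagation k τ (fun σ => w σ τ) := by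
  have key : ∀ τ : ℝ, ∃ v : ℝ → ℝ, 0 ≤ τ → IsPropagation k τ v := by
    intro τ
    by_cases hτ : 0 ≤ τ
    swap
    · exact ⟨0, fun h => absurd h hτ⟩
    obtain ⟨μ, hμ1, hμ⟩ := exists_mlap_of_isKernel hk hτ
    have : IsFiniteMeasure μ := ⟨hμ1.trans_lt ENNReal.one_lt_top⟩
    have hle1 : ∀ t, cdfLt μ t ≤ 1 := fun t => cdfLt_le_one hμ1 t
    have hfin : ∀ t, cdfLt μ t ≠ ⊤ := fun t => ((hle1 t).trans_lt ENNReal.one_lt_top).ne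
    have hmono : Monotone fun t => (cdfLt μ t).toReal := fun s t hst =>
      ENNReal.toReal_mono (hfin t) (cdfLt_mono μ hst)
    have hb : ∀ t, (cdfLt μ t).toReal ≤ 1 := fun t =>
      ENNReal.toReal_le_of_le_ofReal zero_le_one (by simpa using hle1 t)
    refine ⟨fun t => (cdfLt μ t).toReal, fun _ => ⟨hmono.monotoneOn _, ?_, ?_, ?_, ?_⟩⟩
    -- For a monotone function the variation sums telescope, and the values lie in `[0,1]`.
    · have : eVariationOn (fun t => (cdfLt μ t).toReal) (Ici 0) ≤ 1 := by
        refine iSup_le fun q => ?_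
        have hq : Monotone fun i : ℕ => (cdfLt μ (q.2.1 i)).toReal := fun i j hij =>
          hmono (q.2.2.1 hij)
        have hterm : ∀ i, edist (cdfLt μ (q.2.1 (i + 1))).toReal (cdfLt μ (q.2.1 i)).toReal =
            ENNReal.ofReal ((cdfLt μ (q.2.1 (i + 1))).toReal - (cdfLt μ (q.2.1 i)).toReal) := by
          intro i
          rw [edist_dist, Real.dist_eq, abs_of_nonneg (sub_nonneg.2 (hq i.le_succ))]
        simp only [hterm]
        rw [← ENNReal.ofReal_sum_of_nonneg fun i _ => sub_nonneg.2 (hq i.le_succ),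
          Finset.sum_range_sub (fun i => (cdfLt μ (q.2.1 i)).toReal), ← ENNReal.ofReal_one]
        refine ENNReal.ofReal_le_ofReal ?_
        linarith [hb (q.2.1 q.1), (ENNReal.toReal_nonneg : 0 ≤ (cdfLt μ (q.2.1 0)).toReal)]
      exact (this.trans_lt ENNReal.one_lt_top).ne
    · simp [cdfLt_of_nonpos]
    · intro σ _
      rw [← continuousWithinAt_Iio_iff_Iic]
      exact (ENNReal.tendsto_toReal (hfin σ)).comp (tendsto_cdfLt μ σ)
    · intro p hp
      have hInt : IntegrableOn (fun σ => Real.exp (-(p * σ)) * (cdfLt μ σ).toReal) (Ioi 0) :=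
        integrableOn_exp_mul_of_le (C := 1) hp hmono.measurable.aestronglyMeasurable fun t _ => by
          rw [abs_of_nonneg ENNReal.toReal_nonneg]
          exact hb t
      have h1 := lap_ofReal hInt fun t _ => ENNReal.toReal_nonneg
      have h2 : lap (fun t => ENNReal.ofReal (cdfLt μ t).toReal) p = lap (cdfLt μ) p :=
        lap_congr (ae_of_all _ fun t => ENNReal.ofReal_toReal (hfin t)) p
      have h3 := ofReal_mul_lap_cdfLt μ hp
      have hnn : 0 ≤ laplace (fun t => (cdfLt μ t).toReal) p :=
        setIntegral_nonneg measurableSet_Ioi fun t _ =>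
          mul_nonneg (Real.exp_pos _).le ENNReal.toReal_nonneg
      rw [← h2, h1, hμ p hp, ← ENNReal.ofReal_mul hp.le,
        ENNReal.ofReal_eq_ofReal_iff (mul_nonneg hp.le hnn) (Real.exp_pos _).le] at h3
      rw [← h3]
      field_simp
  choose v hv using key
  exact ⟨fun σ τ => v τ σ, fun τ hτ => hv τ hτ⟩

/-! ### Uniqueness for Laplace transforms -/

/-- The bounded continuous function `x ↦ e^{-x}` on `[0,∞)`. -/
def expNegBCF : BoundedContinuousFunction ℝ≥0 ℝ :=
  BoundedContinuousFunction.ofNormedAddCommGroup (fun x : ℝ≥0 => Real.exp (-(x : ℝ)))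
    (by fun_prop) 1 fun x => by
      rw [Real.norm_eq_abs, Real.abs_exp, Real.exp_le_one_iff]
      exact neg_nonpos.2 x.2

lemma expNegBCF_apply (x : ℝ≥0) : expNegBCF x = Real.exp (-(x : ℝ)) := rfl

/-- A finite measure on `[0,∞)` is determined by its Laplace transform at the integers. -/
theorem measure_ext_of_mlap {μ ν : Measure ℝ≥0} [IsFiniteMeasure μ] [IsFiniteMeasure ν]
    (h : ∀ n : ℕ, mlap μ n = mlap ν n) : μ = ν := by
  -- Polynomials in `e^{-x}` separate the points of `[0,∞)`, and integrating them uses only the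
  -- transform at integers.
  let A : StarSubalgebra ℝ (BoundedContinuousFunction ℝ≥0 ℝ) :=
    { Algebra.adjoin ℝ {expNegBCF} with
      star_mem' := fun {a} ha => by
        have : star a = a := by ext x; simp
        rw [this]; exact ha }
  refine ext_of_forall_mem_subalgebra_integral_eq_of_polish (𝕜 := ℝ) (A := A) ?_ ?_
  · intro x y hxy
    refine ⟨fun z => expNegBCF z, ⟨BoundedContinuousFunction.toContinuousMapStarₐ ℝ expNegBCF,
      ⟨expNegBCF, Algebra.subset_adjoin rfl, rfl⟩, rfl⟩, ?_⟩
    simp only [expNegBCF_apply]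
    intro he
    exact hxy (NNReal.coe_injective (neg_injective (Real.exp_injective he)))
  · intro g hg
    have hg' : g ∈ Algebra.adjoin ℝ {expNegBCF} := hg
    rw [Algebra.adjoin_singleton_eq_range_aeval] at hg'
    obtain ⟨q, hq⟩ := hg'
    have hev : ∀ x : ℝ≥0, g x =
        ∑ i ∈ Finset.range (q.natDegree + 1), q.coeff i * Real.exp (-((i : ℝ) * x)) := by
      intro x
      rw [← hq]
      change (Polynomial.aeval expNegBCF q : BoundedContinuousFunction ℝ≥0 ℝ) x = _
      rw [Polynomial.aeval_eq_sum_range]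
      simp only [BoundedContinuousFunction.coe_sum, Finset.sum_apply,
        BoundedContinuousFunction.coe_smul, BoundedContinuousFunction.coe_pow, Pi.pow_apply,
        expNegBCF_apply, smul_eq_mul, ← Real.exp_nat_mul, mul_neg]
    have hInt : ∀ (m : Measure ℝ≥0) [IsFiniteMeasure m] (i : ℕ),
        Integrable (fun x : ℝ≥0 => Real.exp (-((i : ℝ) * x))) m := by
      intro m _ i
      refine Integrable.of_bound (C := 1) (by fun_prop) (ae_of_all _ fun x => ?_)
      rw [Real.norm_eq_abs, Real.abs_exp, Real.exp_le_one_iff]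
      exact neg_nonpos.2 (mul_nonneg i.cast_nonneg x.2)
    simp only [hev]
    rw [integral_finsetSum _ fun i _ => (hInt μ i).const_mul _,
      integral_finsetSum _ fun i _ => (hInt ν i).const_mul _]
    refine Finset.sum_congr rfl fun i _ => ?_
    rw [integral_const_mul, integral_const_mul,
      integral_eq_lintegral_of_nonneg_ae (ae_of_all _ fun _ => (Real.exp_pos _).le) (by fun_prop),
      integral_eq_lintegral_of_nonneg_ae (ae_of_all _ fun _ => (Real.exp_pos _).le) (by fun_prop)]
    have := h i
    simp only [mlap] at this
    rw [this]

/-- A function on `(0,∞)` is determined by its Laplace transform. -/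
theorem ae_eq_of_lap_eq {f g : ℝ → ℝ≥0∞} (hf : AEMeasurable f (volume.restrict (Ioi 0)))
    (hg : AEMeasurable g (volume.restrict (Ioi 0))) (hfin : ∀ p, 0 < p → lap f p ≠ ⊤)
    (h : ∀ p, 0 < p → lap f p = lap g p) :
    ∀ᵐ t ∂(volume.restrict (Ioi 0)), f t = g t := by
  -- The weight `e^{-σ}` makes the measure finite, at the price of shifting the Laplace variable by
  -- `1`.
  let m : (ℝ → ℝ≥0∞) → Measure ℝ := fun F => (volume.restrict (Ioi 0)).withDensity
    fun σ => ENNReal.ofReal (Real.exp (-(1 * σ))) * F σ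
  have hmeas : ∀ F : ℝ → ℝ≥0∞, AEMeasurable F (volume.restrict (Ioi 0)) →
      AEMeasurable (fun σ => ENNReal.ofReal (Real.exp (-(1 * σ))) * F σ)
        (volume.restrict (Ioi 0)) := fun F hF => (measurable_exp_neg_mul 1).aemeasurable.mul hF
  have hml : ∀ F : ℝ → ℝ≥0∞, AEMeasurable F (volume.restrict (Ioi 0)) → ∀ n : ℕ,
      mlap ((m F).map Real.toNNReal) n = lap F (1 + n) := by
    intro F hF n
    rw [mlap, lintegral_map (by fun_prop) (by fun_prop),
      lintegral_withDensity_eq_lintegral_mul₀ (hmeas F hF) (by fun_prop), lap]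
    refine setLIntegral_congr_fun measurableSet_Ioi fun σ hσ => ?_
    simp only [Pi.mul_apply]
    rw [Real.coe_toNNReal _ (le_of_lt hσ), mul_right_comm, ← ENNReal.ofReal_mul (Real.exp_pos _).le,
      ← Real.exp_add]
    congr 4
    ring
  have hfinm : ∀ F : ℝ → ℝ≥0∞, AEMeasurable F (volume.restrict (Ioi 0)) → lap F 1 ≠ ⊤ →
      IsFiniteMeasure ((m F).map Real.toNNReal) := by
    intro F hF hF1
    refine ⟨?_⟩
    have := hml F hF 0
    rw [Nat.cast_zero, mlap_zero, add_zero] at this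
    rw [this]
    exact hF1.lt_top
  have h1 := hfinm f hf (hfin 1 one_pos)
  have h2 := hfinm g hg (by rw [← h 1 one_pos]; exact hfin 1 one_pos)
  have heq : (m f).map Real.toNNReal = (m g).map Real.toNNReal :=
    measure_ext_of_mlap fun n => by rw [hml f hf, hml g hg, h _ (by positivity)]
  have hback : ∀ F, ((m F).map Real.toNNReal).map (fun x : ℝ≥0 => (x : ℝ)) = m F := by
    intro F
    rw [Measure.map_map (by fun_prop) (by fun_prop)]
    conv_rhs => rw [← Measure.map_id (μ := m F)]
    refine Measure.map_congr ?_
    have : ∀ᵐ t ∂(volume.restrict (Ioi (0 : ℝ))), ((Real.toNNReal t : ℝ≥0) : ℝ) = t := by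
      filter_upwards [ae_restrict_mem measurableSet_Ioi] with t ht
      exact Real.coe_toNNReal _ (le_of_lt ht)
    exact (withDensity_absolutelyContinuous _ _).ae_le this
  have hm : m f = m g := by rw [← hback f, heq, hback g]
  have hae := (withDensity_eq_iff (hmeas f hf) (hmeas g hg) (hfin 1 one_pos)).1 hm
  filter_upwards [hae] with t ht
  exact (ENNReal.mul_right_inj (ENNReal.ofReal_pos.2 (Real.exp_pos _)).ne'
    ENNReal.ofReal_ne_top).1 ht

/-! ### Convolution on the half-line -/

/-- Extension by zero from `(0,∞)`. -/
def ext0 (f : ℝ → ℝ≥0∞) : ℝ → ℝ≥0∞ := indicator (Ioi 0) f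

lemma ext0_of_pos {f : ℝ → ℝ≥0∞} {t : ℝ} (ht : 0 < t) : ext0 f t = f t :=
  indicator_of_mem (mem_Ioi.2 ht) f

lemma ext0_of_nonpos {f : ℝ → ℝ≥0∞} {t : ℝ} (ht : t ≤ 0) : ext0 f t = 0 :=
  indicator_of_notMem (by simpa using ht) f

lemma aemeasurable_ext0 {f : ℝ → ℝ≥0∞} (hf : AEMeasurable f (volume.restrict (Ioi 0))) :
    AEMeasurable (ext0 f) := (aemeasurable_indicator_iff measurableSet_Ioi).2 hf

lemma lap_ext0 (f : ℝ → ℝ≥0∞) (p : ℝ) : lap (ext0 f) p = lap f p :=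
  setLIntegral_congr_fun measurableSet_Ioi fun t ht => by simp only [ext0_of_pos (mem_Ioi.1 ht)]

lemma lap_eq_lintegral {f : ℝ → ℝ≥0∞} (h0 : ∀ t ≤ 0, f t = 0) (p : ℝ) :
    lap f p = ∫⁻ σ, ENNReal.ofReal (Real.exp (-(p * σ))) * f σ := by
  rw [lap, ← lintegral_indicator measurableSet_Ioi]
  refine lintegral_congr fun t => ?_
  by_cases ht : 0 < t
  · simp [indicator, ht]
  · simp [h0 t (not_lt.1 ht)]

lemma lconvolution_of_nonpos {f g : ℝ → ℝ≥0∞} (hf : ∀ t ≤ 0, f t = 0) (hg : ∀ t ≤ 0, g t = 0)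
    {t : ℝ} (ht : t ≤ 0) : (f ⋆ₗ g) t = 0 := by
  rw [lconvolution_def]
  refine (lintegral_congr fun s => ?_).trans lintegral_zero
  rcases le_or_gt s 0 with h | h
  · rw [hf s h, zero_mul]
  · rw [hg (-s + t) (by linarith), mul_zero]

/-- The Laplace transform of a convolution is the product of the Laplace transforms. -/
lemma lap_lconvolution {f g : ℝ → ℝ≥0∞} (hfm : AEMeasurable f) (hgm : AEMeasurable g)
    (hf : ∀ t ≤ 0, f t = 0) (hg : ∀ t ≤ 0, g t = 0) (p : ℝ) :
    lap (f ⋆ₗ g) p = lap f p * lap g p := by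
  let e : ℝ → ℝ≥0∞ := fun σ => ENNReal.ofReal (Real.exp (-(p * σ)))
  have he : Measurable e := measurable_exp_neg_mul p
  rw [lap_eq_lintegral (fun t ht => lconvolution_of_nonpos hf hg ht), lap_eq_lintegral hf,
    lap_eq_lintegral hg]
  have hm : AEMeasurable (Function.uncurry fun σ s => (e s * f s) * (e (-s + σ) * g (-s + σ)))
      (volume.prod volume) := by
    simp only [Function.uncurry_def]
    fun_prop
  calc ∫⁻ σ, e σ * (f ⋆ₗ g) σ
      = ∫⁻ σ, ∫⁻ s, (e s * f s) * (e (-s + σ) * g (-s + σ)) := by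
        refine lintegral_congr fun σ => ?_
        rw [lconvolution_def, ← lintegral_const_mul' _ _ ENNReal.ofReal_ne_top]
        refine lintegral_congr fun s => ?_
        have : e σ = e s * e (-s + σ) := by
          simp only [e]
          rw [← ENNReal.ofReal_mul (Real.exp_pos _).le, ← Real.exp_add]
          congr 2
          ring
        change e σ * _ = _
        rw [this]
        ring
    _ = ∫⁻ s, ∫⁻ σ, (e s * f s) * (e (-s + σ) * g (-s + σ)) := lintegral_lintegral_swap hm
    _ = ∫⁻ s, (e s * f s) * ∫⁻ σ, e σ * g σ := by
        refine lintegral_congr fun s => ?_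
        rw [lintegral_add_left_eq_self (fun σ => (e s * f s) * (e σ * g σ)) (-s),
          lintegral_const_mul'' _ (by fun_prop)]
    _ = (∫⁻ σ, e σ * f σ) * ∫⁻ σ, e σ * g σ :=
        lintegral_mul_const'' _ (by fun_prop)

/-! ### Uniqueness from positive arguments and from left limits -/

lemma tendsto_mlap_univ (μ : Measure ℝ≥0) [IsFiniteMeasure μ] :
    Tendsto (fun n : ℕ => mlap μ (1 / ((n : ℝ) + 1))) atTop (𝓝 (μ univ)) := by
  rw [← lintegral_one]
  refine tendsto_lintegral_of_dominated_convergence (fun _ => 1) (fun n => by fun_prop)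
    (fun n => ae_of_all _ fun x => ?_) (by simp) (ae_of_all _ fun x => ?_)
  · rw [← ENNReal.ofReal_one]
    refine ENNReal.ofReal_le_ofReal (Real.exp_le_one_iff.2 ?_)
    have : 0 ≤ 1 / ((n : ℝ) + 1) * x := mul_nonneg (by positivity) x.2
    linarith
  · have h := (tendsto_one_div_add_atTop_nhds_zero_nat (𝕜 := ℝ)).mul_const (x : ℝ)
    have h2 := ENNReal.tendsto_ofReal ((Real.continuous_exp.tendsto _).comp h.neg)
    simpa using h2

/-- The value at `0`, the total mass, is recovered as a limit along `p = 1/(n+1)`. Exponents such as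
`p k̂(p)` are controlled only for `p > 0`. -/
lemma measure_ext_of_mlap_pos {μ ν : Measure ℝ≥0} [IsFiniteMeasure μ] [IsFiniteMeasure ν]
    (h : ∀ p : ℝ, 0 < p → mlap μ p = mlap ν p) : μ = ν := by
  refine measure_ext_of_mlap fun n => ?_
  rcases n.eq_zero_or_pos with rfl | hn
  · rw [Nat.cast_zero, mlap_zero, mlap_zero]
    refine tendsto_nhds_unique (tendsto_mlap_univ μ) ?_
    simpa only [h _ (Nat.one_div_pos_of_nat)] using tendsto_mlap_univ ν
  · exact h _ (by exact_mod_cast hn)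

lemma eq_of_ae_eq_of_tendsto_nhdsLT {X : Type*} [TopologicalSpace X] [T2Space X] {f g : ℝ → X}
    {a b : X} {t : ℝ} (ht : 0 < t) (hf : Tendsto f (𝓝[<] t) (𝓝 a)) (hg : Tendsto g (𝓝[<] t) (𝓝 b))
    (h : ∀ᵐ s ∂(volume.restrict (Ioi (0 : ℝ))), f s = g s) : a = b := by
  refine tendsto_nhds_unique_of_frequently_eq hf hg ?_
  intro hn
  obtain ⟨c, hc, hsub⟩ := (mem_nhdsLT_iff_exists_Ioo_subset' ht).1 hn
  rw [ae_restrict_iff' measurableSet_Ioi] at h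
  have hnull : volume (Ioo (max c 0) t) = 0 := by
    refine measure_mono_null (fun s hs => ?_) h
    simp only [mem_compl_iff, mem_ofPred_eq]
    intro h'
    exact hsub ⟨(le_max_left _ _).trans_lt hs.1, hs.2⟩ (h' ((le_max_right _ _).trans_lt hs.1))
  rw [Real.volume_Ioo, ENNReal.ofReal_eq_zero] at hnull
  have : max c 0 < t := max_lt hc ht
  linarith

/-! ### The subordinator and the mean of its inverse -/

/-- `μ` is a convolution semigroup of subprobability measures on `[0,∞)` with Laplace exponent
`φ`, extended constantly to negative parameters. -/
structure IsSubordinator (φ : ℝ → ℝ) (μ : ℝ → Measure ℝ≥0) : Prop where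
  univ_le_one : ∀ τ, μ τ univ ≤ 1
  mlap_eq : ∀ τ p, 0 < p → mlap (μ τ) p = ENNReal.ofReal (Real.exp (-(max τ 0 * φ p)))

lemma IsKernel.exists_isSubordinator {k : ℝ → ℝ} (hk : IsKernel k) :
    ∃ μ, IsSubordinator (fun p => p * laplace k p) μ := by
  choose μ h1 h2 using fun τ : ℝ => exists_mlap_of_isKernel hk (le_max_right τ 0)
  exact ⟨μ, h1, h2⟩

namespace IsSubordinator

variable {φ : ℝ → ℝ} {μ : ℝ → Measure ℝ≥0}

lemma isFiniteMeasure (h : IsSubordinator φ μ) (τ : ℝ) : IsFiniteMeasure (μ τ) :=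
  ⟨(h.univ_le_one τ).trans_lt ENNReal.one_lt_top⟩

/-- Matches the constant extension to `τ < 0` that is built into `propagationMeasure`. -/
lemma max_zero (h : IsSubordinator φ μ) (τ : ℝ) : μ (max τ 0) = μ τ := by
  have := h.isFiniteMeasure
  refine measure_ext_of_mlap_pos fun p hp => ?_
  rw [h.mlap_eq _ p hp, h.mlap_eq _ p hp]
  simp

lemma add (h : IsSubordinator φ μ) {a b : ℝ} (ha : 0 ≤ a) (hb : 0 ≤ b) :
    μ (a + b) = (μ a).conv (μ b) := by
  have := h.isFiniteMeasure
  refine measure_ext_of_mlap_pos fun p hp => ?_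
  rw [mlap_conv, h.mlap_eq _ p hp, h.mlap_eq _ p hp, h.mlap_eq _ p hp,
    ← ENNReal.ofReal_mul (Real.exp_pos _).le, ← Real.exp_add, max_eq_left ha, max_eq_left hb,
    max_eq_left (add_nonneg ha hb)]
  congr 2
  ring

lemma cdfLt_add_le (h : IsSubordinator φ μ) {a b : ℝ} (ha : 0 ≤ a) (hb : 0 ≤ b) (t : ℝ) :
    cdfLt (μ (a + b)) t ≤ cdfLt (μ a) t * cdfLt (μ b) t := by
  have := h.isFiniteMeasure
  rw [h.add ha hb]
  exact cdfLt_conv_le_mul _ _ _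

lemma cdfLt_le_one (h : IsSubordinator φ μ) (τ t : ℝ) : cdfLt (μ τ) t ≤ 1 :=
  NonlocalDiffusion.cdfLt_le_one (h.univ_le_one τ) t

lemma cdfLt_ne_top (h : IsSubordinator φ μ) (τ t : ℝ) : cdfLt (μ τ) t ≠ ⊤ :=
  ((h.cdfLt_le_one τ t).trans_lt ENNReal.one_lt_top).ne

/-- Enlarging `τ` convolves with one more subprobability measure, and by submultiplicativity this
multiplies the bound by a factor at most `1`. -/
lemma cdfLt_antitone (h : IsSubordinator φ μ) (t : ℝ) : Antitone fun τ => cdfLt (μ τ) t := by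
  intro a b hab
  simp only
  rw [← h.max_zero a, ← h.max_zero b]
  have hab' := max_le_max_right 0 hab
  have := h.cdfLt_add_le (le_max_right a 0) (sub_nonneg.2 hab') t
  rw [add_sub_cancel] at this
  exact this.trans (mul_le_of_le_one_right' (h.cdfLt_le_one _ t))

lemma lap_cdfLt (h : IsSubordinator φ μ) {τ p : ℝ} (hτ : 0 ≤ τ) (hp : 0 < p) :
    lap (cdfLt (μ τ)) p = ENNReal.ofReal (Real.exp (-(τ * φ p)) / p) := by
  have := h.isFiniteMeasure
  have h1 := ofReal_mul_lap_cdfLt (μ τ) hp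
  rw [h.mlap_eq τ p hp, max_eq_left hτ] at h1
  rw [ENNReal.ofReal_div_of_pos hp, ← h1, mul_comm,
    ENNReal.mul_div_cancel_right (ENNReal.ofReal_pos.2 hp).ne' ENNReal.ofReal_ne_top]

/-- Left continuity in `t` writes the function as a supremum over rational times, and at each fixed
time it is monotone in `τ`. Joint measurability is needed for Tonelli in `lap_mean`. -/
lemma measurable_cdfLt (h : IsSubordinator φ μ) :
    Measurable fun z : ℝ × ℝ => cdfLt (μ z.2) z.1 := by
  have key : ∀ z : ℝ × ℝ, cdfLt (μ z.2) z.1 =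
      ⨆ q : ℚ, indicator {z : ℝ × ℝ | (q : ℝ) < z.1} (fun z => cdfLt (μ z.2) q) z := by
    intro z
    refine le_antisymm ?_ (iSup_le fun q => ?_)
    · refine le_of_tendsto (tendsto_cdfLt (μ z.2) z.1) ?_
      filter_upwards [self_mem_nhdsWithin] with s hs
      obtain ⟨q, hq1, hq2⟩ := exists_rat_btwn (mem_Iio.1 hs)
      refine (cdfLt_mono _ hq1.le).trans (le_iSup_of_le q ?_)
      rw [indicator_of_mem (by exact hq2)]
    · by_cases hq : (q : ℝ) < z.1
      · rw [indicator_of_mem (by exact hq)]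
        exact cdfLt_mono _ hq.le
      · rw [indicator_of_notMem (by exact hq)]
        exact zero_le
  simp only [key]
  refine Measurable.iSup fun q => Measurable.indicator ?_ ?_
  · exact (h.cdfLt_antitone q).measurable.comp measurable_snd
  · exact measurableSet_lt measurable_const measurable_fst

/-- The propagation function of a kernel is the distribution function of its subordinator. -/
lemma eq_cdfLt_of_isPropagation {k v : ℝ → ℝ}
    (h : IsSubordinator (fun p => p * laplace k p) μ) {τ : ℝ} (hτ : 0 ≤ τ)
    (hv : IsPropagation k τ v) {t : ℝ} (ht : 0 < t) : v t = (cdfLt (μ τ) t).toReal := by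
  have hv0 : ∀ s, 0 < s → 0 ≤ v s := fun s hs => by
    rw [← hv.zero]
    exact hv.mono (mem_Ici.2 le_rfl) (mem_Ici.2 hs.le) hs.le
  have hlap : ∀ p, 0 < p → lap (fun s => ENNReal.ofReal (v s)) p = lap (cdfLt (μ τ)) p := by
    intro p hp
    have hne : laplace v p ≠ 0 := by
      rw [hv.laplace_eq p hp]
      positivity
    rw [lap_ofReal (Integrable.of_integral_ne_zero hne) hv0, hv.laplace_eq p hp,
      h.lap_cdfLt hτ hp]
  have hmeas : AEMeasurable v (volume.restrict (Ioi 0)) :=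
    aemeasurable_restrict_of_monotoneOn measurableSet_Ioi (hv.mono.mono Ioi_subset_Ici_self)
  have hae := ae_eq_of_lap_eq hmeas.ennreal_ofReal (cdfLt_mono (μ τ)).measurable.aemeasurable
    (fun p hp => by rw [hlap p hp, h.lap_cdfLt hτ hp]; exact ENNReal.ofReal_ne_top) hlap
  have hleft : Tendsto v (𝓝[<] t) (𝓝 (v t)) := (hv.leftCont t ht).mono Iio_subset_Iic_self
  have := eq_of_ae_eq_of_tendsto_nhdsLT ht (ENNReal.tendsto_ofReal hleft)
    (tendsto_cdfLt (μ τ) t) hae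
  rw [← this, ENNReal.toReal_ofReal (hv0 t ht)]

lemma propagation_eq {k : ℝ → ℝ} (hk : IsKernel k)
    (h : IsSubordinator (fun p => p * laplace k p) μ) {τ t : ℝ} (hτ : 0 ≤ τ) (ht : 0 < t) :
    propagation k t τ = (cdfLt (μ τ) t).toReal := by
  have hex := exists_isPropagation hk
  have hp : propagation k = hex.choose := dif_pos hex
  rw [hp]
  exact h.eq_cdfLt_of_isPropagation hτ (hex.choose_spec τ hτ) ht

/-- The mean `∫₀^∞ w(t,τ) dτ` of the measure `-w(t,dτ)`. -/
lemma lap_mean (h : IsSubordinator φ μ) {p : ℝ} (hp : 0 < p) (hφ : 0 < φ p) :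
    lap (fun t => ∫⁻ τ in Ioi (0 : ℝ), cdfLt (μ τ) t) p = ENNReal.ofReal (1 / (φ p * p)) := by
  have hm : Measurable fun z : ℝ × ℝ =>
      ENNReal.ofReal (Real.exp (-(p * z.1))) * cdfLt (μ z.2) z.1 :=
    Measurable.mul (by fun_prop) h.measurable_cdfLt
  have hm1 : ∀ t, Measurable fun τ => cdfLt (μ τ) t := fun t => (h.cdfLt_antitone t).measurable
  calc lap (fun t => ∫⁻ τ in Ioi (0 : ℝ), cdfLt (μ τ) t) p
      = ∫⁻ t in Ioi (0 : ℝ), ∫⁻ τ in Ioi (0 : ℝ),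
          ENNReal.ofReal (Real.exp (-(p * t))) * cdfLt (μ τ) t :=
        lintegral_congr fun t => (lintegral_const_mul _ (hm1 t)).symm
    _ = ∫⁻ τ in Ioi (0 : ℝ), lap (cdfLt (μ τ)) p := lintegral_lintegral_swap hm.aemeasurable
    _ = ∫⁻ τ in Ioi (0 : ℝ), ENNReal.ofReal (Real.exp (-(φ p * τ))) * ENNReal.ofReal (1 / p) := by
        refine setLIntegral_congr_fun measurableSet_Ioi fun τ hτ => ?_
        rw [h.lap_cdfLt (le_of_lt hτ) hp, ← ENNReal.ofReal_mul (Real.exp_pos _).le, mul_comm τ,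
          mul_one_div]
    _ = _ := by
        rw [lintegral_mul_const _ (by fun_prop), lintegral_exp_Ioi hφ,
          ← ENNReal.ofReal_mul (by positivity)]
        congr 1
        simp
        ring

lemma mean_mono : Monotone fun t => ∫⁻ τ in Ioi (0 : ℝ), cdfLt (μ τ) t :=
  fun _ _ hst => lintegral_mono fun τ => cdfLt_mono (μ τ) hst

lemma tendsto_mean (h : IsSubordinator φ μ) (t : ℝ) :
    Tendsto (fun t => ∫⁻ τ in Ioi (0 : ℝ), cdfLt (μ τ) t) (𝓝[<] t)
      (𝓝 (∫⁻ τ in Ioi (0 : ℝ), cdfLt (μ τ) t)) := by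
  obtain ⟨u, hu, hut, hulim⟩ := exists_seq_strictMono_tendsto t
  refine tendsto_nhdsLT_of_le_iSup mean_mono hut ?_
  rw [← lintegral_iSup (fun n => (h.cdfLt_antitone (u n)).measurable)
    (fun m n hmn τ => cdfLt_mono _ (hu.monotone hmn))]
  refine lintegral_mono fun τ => ?_
  refine le_of_tendsto' ((tendsto_cdfLt (μ τ) t).comp
    (tendsto_nhdsWithin_iff.2 ⟨hulim, Eventually.of_forall hut⟩)) fun n => ?_
  exact le_iSup (fun n => cdfLt (μ τ) (u n)) n

/-- The mean is nondecreasing in `t`, so an infinite value would persist for all later times and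
make its Laplace transform infinite, against `lap_mean`. -/
lemma mean_ne_top (h : IsSubordinator φ μ) {p : ℝ} (hp : 0 < p) (hφ : 0 < φ p) (t : ℝ) :
    ∫⁻ τ in Ioi (0 : ℝ), cdfLt (μ τ) t ≠ ⊤ := by
  intro htop
  have hl := h.lap_mean hp hφ
  have hbig : lap (fun t => ∫⁻ τ in Ioi (0 : ℝ), cdfLt (μ τ) t) p = ⊤ := by
    rw [eq_top_iff]
    calc (⊤ : ℝ≥0∞) = ∫⁻ s in Ioi (max t 0), ENNReal.ofReal (Real.exp (-(p * s))) * ⊤ := by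
          rw [lintegral_mul_const _ (by fun_prop), lintegral_exp_Ioi hp, ENNReal.mul_top]
          exact (ENNReal.ofReal_pos.2 (by positivity)).ne'
      _ ≤ ∫⁻ s in Ioi (max t 0), ENNReal.ofReal (Real.exp (-(p * s))) *
            ∫⁻ τ in Ioi (0 : ℝ), cdfLt (μ τ) s := by
          refine setLIntegral_mono' measurableSet_Ioi fun s hs => ?_
          have : ∫⁻ τ in Ioi (0 : ℝ), cdfLt (μ τ) s = ⊤ := by
            rw [eq_top_iff, ← htop]
            exact mean_mono ((le_max_left _ _).trans (le_of_lt hs))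
          rw [this]
      _ ≤ _ := lintegral_mono_set (Ioi_subset_Ioi (le_max_right _ _))
  rw [hbig] at hl
  exact ENNReal.ofReal_ne_top hl.symm

/-- The relaxation estimate in integrated form: `L ≤ A + q L A` with `L = ∫ w(t,τ) dτ` and
`A = ∫ e^{-qτ} w(t,τ) dτ`. -/
lemma mean_le (h : IsSubordinator φ μ) {q : ℝ} (hq : 0 < q) (t : ℝ) :
    ∫⁻ τ in Ioi (0 : ℝ), cdfLt (μ τ) t ≤ lap (fun τ => cdfLt (μ τ) t) q +
      ENNReal.ofReal q * lap (fun τ => cdfLt (μ τ) t) q *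
        ∫⁻ τ in Ioi (0 : ℝ), cdfLt (μ τ) t := by
  set W : ℝ → ℝ≥0∞ := fun τ => cdfLt (μ τ) t with hW
  have hWm : Measurable W := (h.cdfLt_antitone t).measurable
  let e : ℝ → ℝ≥0∞ := fun b => ENNReal.ofReal (Real.exp (-(q * b)))
  have he : Measurable e := measurable_exp_neg_mul q
  -- Multiply `W τ` by `1 = e^{-qτ} + q ∫₀^τ e^{-qb} db`.
  have hsplit : ∀ τ, 0 < τ → W τ = e τ * W τ +
      ENNReal.ofReal q * ∫⁻ b in Ioi (0 : ℝ), e b * indicator (Ioi b) W τ := by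
    intro τ hτ
    have h1 : ∫⁻ b in Ioi (0 : ℝ), e b * indicator (Ioi b) W τ =
        (∫⁻ b in Ioo (0 : ℝ) τ, e b) * W τ := by
      rw [← lintegral_mul_const _ he, ← lintegral_indicator measurableSet_Ioi,
        ← lintegral_indicator measurableSet_Ioo]
      refine lintegral_congr fun b => ?_
      by_cases hb : 0 < b <;> by_cases hbτ : b < τ <;> simp [indicator, hb, hbτ]
    have h2 : e τ + ENNReal.ofReal q * ∫⁻ b in Ioo (0 : ℝ) τ, e b = 1 := by
      have h3 : ∫⁻ b in Ioi (0 : ℝ), e b = (∫⁻ b in Ioo (0 : ℝ) τ, e b) + ∫⁻ b in Ici τ, e b := by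
        rw [← lintegral_union measurableSet_Ici, Ioo_union_Ici_eq_Ioi hτ]
        exact disjoint_left.2 fun x hx hx' => absurd hx.2 (not_lt.2 hx')
      rw [setLIntegral_congr (Ioi_ae_eq_Ici (a := τ)).symm] at h3
      simp only [e] at h3 ⊢
      rw [lintegral_exp_Ioi hq, lintegral_exp_Ioi hq] at h3
      have h4 := congrArg (fun x => ENNReal.ofReal q * x) h3
      simp only [mul_add] at h4
      rw [← ENNReal.ofReal_mul hq.le, ← ENNReal.ofReal_mul hq.le, mul_div_cancel₀ _ hq.ne',
        mul_div_cancel₀ _ hq.ne'] at h4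
      rw [add_comm, ← h4]
      simp
    rw [h1, ← mul_assoc, ← add_mul, h2, one_mul]
  have hmeas : Measurable fun z : ℝ × ℝ => e z.2 * indicator (Ioi z.2) W z.1 := by
    refine (he.comp measurable_snd).mul ?_
    have : (fun z : ℝ × ℝ => indicator (Ioi z.2) W z.1) =
        indicator {z : ℝ × ℝ | z.2 < z.1} (fun z => W z.1) := by
      ext z
      simp [indicator]
    rw [this]
    exact (hWm.comp measurable_fst).indicator (measurableSet_lt measurable_snd measurable_fst)
  calc ∫⁻ τ in Ioi (0 : ℝ), W τ
      = ∫⁻ τ in Ioi (0 : ℝ), (e τ * W τ +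
          ENNReal.ofReal q * ∫⁻ b in Ioi (0 : ℝ), e b * indicator (Ioi b) W τ) :=
        setLIntegral_congr_fun measurableSet_Ioi fun τ hτ => hsplit τ hτ
    _ = lap W q + ENNReal.ofReal q *
          ∫⁻ τ in Ioi (0 : ℝ), ∫⁻ b in Ioi (0 : ℝ), e b * indicator (Ioi b) W τ := by
        rw [lintegral_add_left (by fun_prop), lintegral_const_mul' _ _ ENNReal.ofReal_ne_top]
        rfl
    _ = lap W q + ENNReal.ofReal q *
          ∫⁻ b in Ioi (0 : ℝ), ∫⁻ τ in Ioi (0 : ℝ), e b * indicator (Ioi b) W τ := by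
        rw [lintegral_lintegral_swap hmeas.aemeasurable]
    _ ≤ lap W q + ENNReal.ofReal q *
          ∫⁻ b in Ioi (0 : ℝ), (e b * W b) * ∫⁻ τ in Ioi (0 : ℝ), W τ := by
        refine add_le_add_right (mul_le_mul_right ?_ _) _
        refine setLIntegral_mono' measurableSet_Ioi fun b hb => ?_
        rw [lintegral_const_mul' _ _ ENNReal.ofReal_ne_top, mul_assoc]
        gcongr
        -- Shift by `b`, then use `W (τ + b) ≤ W τ * W b`: the tail of the mean beyond `b` is at
        -- most `W b` times the whole mean.
        calc ∫⁻ τ in Ioi (0 : ℝ), indicator (Ioi b) W τ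
            ≤ ∫⁻ τ, indicator (Ioi b) W τ := setLIntegral_le_lintegral _ _
          _ = ∫⁻ τ, indicator (Ioi b) W (τ + b) := (lintegral_add_right_eq_self _ b).symm
          _ = ∫⁻ τ in Ioi (0 : ℝ), W (τ + b) := by
              rw [← lintegral_indicator measurableSet_Ioi]
              refine lintegral_congr fun τ => ?_
              simp [indicator]
          _ ≤ ∫⁻ τ in Ioi (0 : ℝ), W b * W τ := by
              refine setLIntegral_mono' measurableSet_Ioi fun τ hτ => ?_
              rw [mul_comm]
              exact h.cdfLt_add_le (le_of_lt hτ) (le_of_lt hb) t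
          _ = W b * ∫⁻ τ in Ioi (0 : ℝ), W τ := lintegral_const_mul _ hWm
    _ = _ := by
        rw [lintegral_mul_const _ (by fun_prop), ← mul_assoc]
        rfl

end IsSubordinator

/-! ### The mean equals `(1 * ℓ)(t)` -/

lemma lconvolution_congr_left {f f' : ℝ → ℝ≥0∞} (h : f =ᵐ[volume] f') (g : ℝ → ℝ≥0∞) :
    f ⋆ₗ g = f' ⋆ₗ g := by
  ext t
  rw [lconvolution_def, lconvolution_def]
  exact lintegral_congr_ae (h.mono fun s hs => by simp only [hs])

lemma one_lconvolution (f : ℝ → ℝ≥0∞) (t : ℝ) :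
    (ext0 (fun _ => 1) ⋆ₗ f) t = ∫⁻ s in Iio t, f s := by
  rw [lconvolution_comm, lconvolution_def, ← lintegral_indicator measurableSet_Iio]
  refine lintegral_congr fun s => ?_
  by_cases h : s < t
  · rw [ext0_of_pos (by linarith), indicator_of_mem (mem_Iio.2 h), mul_one]
  · rw [ext0_of_nonpos (by linarith), indicator_of_notMem (by simpa using h), mul_zero]

lemma lintegral_Iio_mono (f : ℝ → ℝ≥0∞) : Monotone fun t => ∫⁻ s in Iio t, f s :=
  fun _ _ h => lintegral_mono_set (Iio_subset_Iio h)

lemma tendsto_lintegral_Iio (f : ℝ → ℝ≥0∞) (t : ℝ) :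
    Tendsto (fun t => ∫⁻ s in Iio t, f s) (𝓝[<] t) (𝓝 (∫⁻ s in Iio t, f s)) := by
  have := tendsto_measure_Iio (m := volume.withDensity f) t
  simpa only [withDensity_apply _ measurableSet_Iio] using this

/-- For `s < t`, monotonicity gives `f s (t - s) ≤ ∫_s^t f = ∫_s^t g ≤ g t (t - s)`; then let `s`
increase to `t`. Applied in both directions, it differentiates an equality of primitives at every
point. -/
lemma le_of_lintegral_Iio_eq {f g : ℝ → ℝ≥0∞} (hf : Monotone f) (hg : Monotone g) {t : ℝ}
    (hft : Tendsto f (𝓝[<] t) (𝓝 (f t))) (h : ∀ s, ∫⁻ x in Iio s, f x = ∫⁻ x in Iio s, g x)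
    (hfin : ∫⁻ x in Iio t, f x ≠ ⊤) : f t ≤ g t := by
  refine le_of_tendsto hft ?_
  filter_upwards [self_mem_nhdsWithin] with s hs
  have hst : s < t := hs
  have hsplit : ∀ F : ℝ → ℝ≥0∞,
      ∫⁻ x in Iio t, F x = (∫⁻ x in Iio s, F x) + ∫⁻ x in Ico s t, F x := by
    intro F
    rw [← lintegral_union measurableSet_Ico, Iio_union_Ico_eq_Iio hst.le]
    exact disjoint_left.2 fun x hx hx' => absurd hx (not_lt.2 hx'.1)
  have h1 := h t
  rw [hsplit f, hsplit g, ← h s] at h1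
  have hne : ∫⁻ x in Iio s, f x ≠ ⊤ :=
    ((lintegral_Iio_mono f hst.le).trans_lt hfin.lt_top).ne
  have h2 := (ENNReal.add_right_inj hne).1 h1
  have h3 : f s * volume (Ico s t) ≤ g t * volume (Ico s t) := by
    rw [← setLIntegral_const, ← setLIntegral_const]
    calc _ ≤ ∫⁻ x in Ico s t, f x := setLIntegral_mono' measurableSet_Ico fun x hx => hf hx.1
      _ = ∫⁻ x in Ico s t, g x := h2
      _ ≤ _ := setLIntegral_mono' measurableSet_Ico fun x hx => hg hx.2.le
  have hpos : volume (Ico s t) ≠ 0 := by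
    rw [Real.volume_Ico]
    exact (ENNReal.ofReal_pos.2 (sub_pos.2 hst)).ne'
  have hfinv : volume (Ico s t) ≠ ⊤ := by simp
  exact (ENNReal.mul_le_mul_iff_left hpos hfinv).1 h3

lemma lintegral_Iio_ext0 (f : ℝ → ℝ≥0∞) (t : ℝ) :
    ∫⁻ s in Iio t, ext0 f s = ∫⁻ s in Ioo 0 t, f s := by
  rw [ext0, setLIntegral_indicator measurableSet_Ioi, Ioi_inter_Iio]

/-- `k * ℓ = 1`, stated with the positive and negative parts of `ℓ`. -/
lemma IsPC.lconvolution_eq {k ℓ : ℝ → ℝ} (h : IsPC k ℓ) :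
    ext0 (fun t => ENNReal.ofReal (k t)) ⋆ₗ ext0 (fun t => ENNReal.ofReal (ℓ t)) =ᵐ[volume]
      ext0 (fun _ => 1) + ext0 (fun t => ENNReal.ofReal (k t)) ⋆ₗ
        ext0 (fun t => ENNReal.ofReal (-ℓ t)) := by
  have hae := h.conv_eq_one
  rw [ae_restrict_iff' measurableSet_Ioi] at hae
  filter_upwards [hae] with t ht
  rcases le_or_gt t 0 with h0 | h0
  · rw [Pi.add_apply, lconvolution_of_nonpos (fun _ hs => ext0_of_nonpos hs)
      (fun _ hs => ext0_of_nonpos hs) h0, lconvolution_of_nonpos (fun _ hs => ext0_of_nonpos hs)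
      (fun _ hs => ext0_of_nonpos hs) h0, ext0_of_nonpos h0, add_zero]
  have h1 := ht h0
  rw [timeConv, intervalIntegral.integral_of_le h0.le, integral_Ioc_eq_integral_Ioo] at h1
  -- A Bochner integral with the nonzero value `1` is not the default value, so the integrand is
  -- integrable.
  have hInt : IntegrableOn (fun s => k (t - s) * ℓ s) (Ioo 0 t) :=
    Integrable.of_integral_ne_zero (by rw [h1]; exact one_ne_zero)
  have hconv : ∀ m : ℝ → ℝ, (ext0 (fun t => ENNReal.ofReal (k t)) ⋆ₗ
      ext0 (fun t => ENNReal.ofReal (m t))) t =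
      ∫⁻ s in Ioo 0 t, ENNReal.ofReal (k (t - s) * m s) := by
    intro m
    rw [lconvolution_comm, lconvolution_def, ← lintegral_indicator measurableSet_Ioo]
    refine lintegral_congr fun s => ?_
    by_cases hs0 : 0 < s
    · by_cases hst : s < t
      · rw [ext0_of_pos hs0, ext0_of_pos (by linarith), indicator_of_mem (mem_Ioo.2 ⟨hs0, hst⟩),
          ENNReal.ofReal_mul (h.nonneg_k _ (by linarith)), mul_comm, neg_add_eq_sub]
      · rw [ext0_of_nonpos (t := -s + t) (by linarith), mul_zero,
          indicator_of_notMem fun hm => hst hm.2]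
    · rw [ext0_of_nonpos (t := s) (by linarith), zero_mul,
          indicator_of_notMem fun hm => hs0 hm.1]
  rw [Pi.add_apply, hconv, hconv, ext0_of_pos h0]
  rw [integral_eq_lintegral_pos_part_sub_lintegral_neg_part hInt] at h1
  simp only [← mul_neg] at h1
  have hA : ∫⁻ s in Ioo 0 t, ENNReal.ofReal (k (t - s) * ℓ s) ≠ ⊤ := hInt.lintegral_lt_top.ne
  have hB : ∫⁻ s in Ioo 0 t, ENNReal.ofReal (k (t - s) * -ℓ s) ≠ ⊤ := by
    have := hInt.neg.lintegral_lt_top.ne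
    simpa only [Pi.neg_apply, ← mul_neg] using this
  rw [← ENNReal.toReal_eq_toReal_iff' hA (ENNReal.add_ne_top.2 ⟨ENNReal.one_ne_top, hB⟩),
    ENNReal.toReal_add ENNReal.one_ne_top hB, ENNReal.toReal_one]
  linarith

lemma IsPC.aemeasurable_l {k ℓ : ℝ → ℝ} (h : IsPC k ℓ) :
    AEMeasurable ℓ (volume.restrict (Ioi 0)) := by
  have hU : Ioi (0 : ℝ) = ⋃ n : ℕ, Ioc (0 : ℝ) (n + 1) := by
    ext x
    simp only [mem_Ioi, mem_iUnion, mem_Ioc, exists_and_left]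
    refine ⟨fun hx => ⟨hx, ?_⟩, fun hx => hx.1⟩
    obtain ⟨n, hn⟩ := exists_nat_ge x
    exact ⟨n, by linarith⟩
  rw [hU]
  exact AEMeasurable.iUnion fun n =>
    (h.locallyIntegrable_l (n + 1) (by positivity)).aemeasurable

/-- If `k̂(p) = 0`, then `k * ℓ⁺` has zero Laplace transform at `p`; but `k * ℓ⁺ = 1 + k * ℓ⁻ ≥ 1`
a.e. on `(0,∞)`. -/
lemma IsPC.laplace_pos {k ℓ : ℝ → ℝ} (h : IsPC k ℓ) {p : ℝ} (hp : 0 < p) : 0 < laplace k p := by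
  refine lt_of_le_of_ne (h.isKernel.laplace_nonneg p) fun h0 => ?_
  have hk0 : lap (ext0 fun t => ENNReal.ofReal (k t)) p = 0 := by
    rw [lap_ext0, lap_ofReal (h.isKernel.integrableOn_exp_mul hp) h.nonneg_k, ← h0,
      ENNReal.ofReal_zero]
  have h1 := lap_lconvolution (aemeasurable_ext0 h.isKernel.aemeasurable.ennreal_ofReal)
    (aemeasurable_ext0 h.aemeasurable_l.ennreal_ofReal) (fun t ht => ext0_of_nonpos ht)
    (fun t ht => ext0_of_nonpos ht) p
  rw [hk0, zero_mul, lap_congr (ae_restrict_of_ae h.lconvolution_eq)] at h1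
  have h2 : lap (fun _ => 1) p ≤ 0 := by
    rw [← h1, ← lap_ext0]
    refine lintegral_mono fun t => ?_
    gcongr
    exact le_self_add
  rw [lap_one hp, nonpos_iff_eq_zero, ENNReal.ofReal_eq_zero] at h2
  have : 0 < 1 / p := by positivity
  linarith

section

variable {k ℓ : ℝ → ℝ} {μ : ℝ → Measure ℝ≥0}

/-- Both sides have Laplace transform `1/p²`, since that of the mean is `1/(p² k̂(p))`. -/
lemma IsPC.lconvolution_mean (h : IsPC k ℓ)
    (hμ : IsSubordinator (fun p => p * laplace k p) μ) :
    ext0 (fun t => ENNReal.ofReal (k t)) ⋆ₗ ext0 (fun t => ∫⁻ τ in Ioi (0 : ℝ), cdfLt (μ τ) t)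
      =ᵐ[volume] ext0 (fun _ => 1) ⋆ₗ ext0 (fun _ => 1) := by
  have hkm := aemeasurable_ext0 h.isKernel.aemeasurable.ennreal_ofReal
  have hLm : AEMeasurable (ext0 fun t => ∫⁻ τ in Ioi (0 : ℝ), cdfLt (μ τ) t) :=
    aemeasurable_ext0 IsSubordinator.mean_mono.measurable.aemeasurable
  have h1m : AEMeasurable (ext0 fun _ => 1) := aemeasurable_ext0 aemeasurable_const
  have hz : ∀ f : ℝ → ℝ≥0∞, ∀ t ≤ 0, ext0 f t = 0 := fun f t ht => ext0_of_nonpos ht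
  have hl1 : ∀ p, 0 < p → lap (ext0 (fun _ => 1) ⋆ₗ ext0 (fun _ => 1)) p =
      ENNReal.ofReal (1 / p * (1 / p)) := fun p hp => by
    rw [lap_lconvolution h1m h1m (hz _) (hz _), lap_ext0, lap_one hp,
      ← ENNReal.ofReal_mul (by positivity)]
  have hae := ae_eq_of_lap_eq (aemeasurable_lconvolution h1m h1m).restrict
    (aemeasurable_lconvolution hkm hLm).restrict
    (fun p hp => by rw [hl1 p hp]; exact ENNReal.ofReal_ne_top) fun p hp => by
      have hkp := h.laplace_pos hp
      rw [hl1 p hp, lap_lconvolution hkm hLm (hz _) (hz _), lap_ext0, lap_ext0,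
        lap_ofReal (h.isKernel.integrableOn_exp_mul hp) h.nonneg_k,
        hμ.lap_mean hp (mul_pos hp hkp), ← ENNReal.ofReal_mul hkp.le]
      congr 1
      field_simp
  rw [ae_restrict_iff' measurableSet_Ioi] at hae
  filter_upwards [hae] with t ht
  rcases le_or_gt t 0 with h0 | h0
  · rw [lconvolution_of_nonpos (hz _) (hz _) h0, lconvolution_of_nonpos (hz _) (hz _) h0]
  · exact (ht h0).symm

/-- A zero of the nondecreasing mean at `t` would make `k * L` vanish on `(0,t)`, where it equals
`s` almost everywhere. -/
lemma IsPC.mean_pos (h : IsPC k ℓ) (hμ : IsSubordinator (fun p => p * laplace k p) μ) {t : ℝ}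
    (ht : 0 < t) : ∫⁻ τ in Ioi (0 : ℝ), cdfLt (μ τ) t ≠ 0 := by
  intro h0
  have hae := h.lconvolution_mean hμ
  have hnull : volume (Ioo 0 t) = 0 := by
    refine measure_mono_null (fun s hs => ?_) hae
    simp only [mem_compl_iff, mem_ofPred_eq]
    intro h'
    rw [one_lconvolution, lintegral_Iio_ext0, setLIntegral_const, one_mul, Real.volume_Ioo,
      lconvolution_def] at h'
    have hz : ∫⁻ y, ext0 (fun t => ENNReal.ofReal (k t)) y *
        ext0 (fun t => ∫⁻ τ in Ioi (0 : ℝ), cdfLt (μ τ) t) (-y + s) = 0 := by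
      refine (lintegral_congr fun y => ?_).trans lintegral_zero
      rcases le_or_gt y 0 with hy | hy
      · rw [ext0_of_nonpos hy, zero_mul]
      rcases le_or_gt (-y + s) 0 with hys | hys
      · rw [ext0_of_nonpos hys, mul_zero]
      · rw [ext0_of_pos hys]
        have : ∫⁻ τ in Ioi (0 : ℝ), cdfLt (μ τ) (-y + s) = 0 := by
          refine le_antisymm ?_ zero_le
          rw [← h0]
          exact IsSubordinator.mean_mono (by linarith [hs.2])
        rw [this, mul_zero]
    rw [hz, sub_zero, eq_comm, ENNReal.ofReal_eq_zero] at h'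
    linarith [hs.1]
  rw [Real.volume_Ioo, ENNReal.ofReal_eq_zero] at hnull
  linarith

/-- The mean of `-w(t,dτ)` is `(1 * ℓ)(t)`. -/
theorem IsPC.timeConv_one_eq (h : IsPC k ℓ) (hμ : IsSubordinator (fun p => p * laplace k p) μ)
    {t : ℝ} (ht : 0 < t) :
    timeConv (fun _ => 1) ℓ t = (∫⁻ τ in Ioi (0 : ℝ), cdfLt (μ τ) t).toReal := by
  set K := ext0 fun t => ENNReal.ofReal (k t) with hK
  set M := ext0 fun t => ∫⁻ τ in Ioi (0 : ℝ), cdfLt (μ τ) t with hM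
  set I := ext0 fun _ => 1 with hI
  set P := ext0 fun t => ENNReal.ofReal (ℓ t) with hP
  set N := ext0 fun t => ENNReal.ofReal (-ℓ t) with hN
  have hKm : AEMeasurable K := aemeasurable_ext0 h.isKernel.aemeasurable.ennreal_ofReal
  have hMm : AEMeasurable M := aemeasurable_ext0 IsSubordinator.mean_mono.measurable.aemeasurable
  have hIm : AEMeasurable I := aemeasurable_ext0 aemeasurable_const
  have hPm : AEMeasurable P := aemeasurable_ext0 h.aemeasurable_l.ennreal_ofReal
  have hNm : AEMeasurable N := aemeasurable_ext0 h.aemeasurable_l.neg.ennreal_ofReal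
  -- Associativity moves `K` next to `M`, and `K * M = 1 * 1`. The argument stays with convolutions
  -- because `ℓ` is only locally integrable and its Laplace integral may diverge.
  have hassoc : ∀ F : ℝ → ℝ≥0∞, AEMeasurable F → (K ⋆ₗ F) ⋆ₗ M = I ⋆ₗ (I ⋆ₗ F) := by
    intro F hF
    rw [lconvolution_comm (f := K) (g := F), ← lconvolution_assoc₀ hF hKm hMm, lconvolution_comm,
      lconvolution_congr_left (h.lconvolution_mean hμ), ← lconvolution_assoc₀ hIm hIm hF]
  -- `ℓ` may change sign, so `1 * L = 1 * (1 * ℓ)` is stated without subtraction: `1 * (1 * ℓ⁺) = 1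
  -- * (L + 1 * ℓ⁻)`.
  have hmain : ∀ s, ∫⁻ x in Iio s, (I ⋆ₗ P) x = ∫⁻ x in Iio s, (M + I ⋆ₗ N) x := by
    intro s
    have h1 : (K ⋆ₗ P) ⋆ₗ M = (I + K ⋆ₗ N) ⋆ₗ M := lconvolution_congr_left h.lconvolution_eq M
    have h2 : (I + K ⋆ₗ N) ⋆ₗ M = I ⋆ₗ M + (K ⋆ₗ N) ⋆ₗ M := by
      ext x
      simp only [lconvolution_def, Pi.add_apply, add_mul]
      exact lintegral_add_left' (by fun_prop) _
    rw [h2, hassoc P hPm, hassoc N hNm] at h1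
    have h3 := congrFun h1 s
    rw [Pi.add_apply, one_lconvolution, one_lconvolution, one_lconvolution] at h3
    rw [h3, ← lintegral_add_left' hMm.restrict]
    rfl
  have hconvI : ∀ F : ℝ → ℝ≥0∞, I ⋆ₗ F = fun t => ∫⁻ s in Iio t, F s := fun F => by
    ext s
    exact one_lconvolution F s
  have hInt : IntegrableOn ℓ (Ioo 0 t) := (h.locallyIntegrable_l t ht).mono_set Ioo_subset_Ioc_self
  have hPt : ∫⁻ s in Iio t, P s ≠ ⊤ := by
    rw [hP, lintegral_Iio_ext0]
    exact hInt.lintegral_lt_top.ne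
  have hNt : ∫⁻ s in Iio t, N s ≠ ⊤ := by
    rw [hN, lintegral_Iio_ext0]
    exact hInt.neg.lintegral_lt_top.ne
  have hPmono : Monotone (I ⋆ₗ P) := by rw [hconvI]; exact lintegral_Iio_mono P
  have hMmono : Monotone M := by
    intro a b hab
    rcases le_or_gt a 0 with ha | ha
    · rw [hM, ext0_of_nonpos ha]
      exact zero_le
    · rw [hM, ext0_of_pos ha, ext0_of_pos (ha.trans_le hab)]
      exact IsSubordinator.mean_mono hab
  have hQmono : Monotone (M + I ⋆ₗ N) := by
    rw [hconvI]
    exact hMmono.add (lintegral_Iio_mono N)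
  have hPlim : Tendsto (I ⋆ₗ P) (𝓝[<] t) (𝓝 ((I ⋆ₗ P) t)) := by
    rw [hconvI]
    exact tendsto_lintegral_Iio P t
  have hMlim : Tendsto M (𝓝[<] t) (𝓝 (M t)) := by
    rw [hM, ext0_of_pos ht]
    refine (hμ.tendsto_mean t).congr' ?_
    filter_upwards [mem_nhdsWithin_of_mem_nhds (Ioi_mem_nhds ht)] with s hs
    rw [ext0_of_pos hs]
  have hQlim : Tendsto (M + I ⋆ₗ N) (𝓝[<] t) (𝓝 ((M + I ⋆ₗ N) t)) := by
    rw [hconvI]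
    exact hMlim.add (tendsto_lintegral_Iio N t)
  have hfin : ∫⁻ x in Iio t, (I ⋆ₗ P) x ≠ ⊤ := by
    have hz : I ⋆ₗ P = ext0 (I ⋆ₗ P) := by
      ext s
      rcases le_or_gt s 0 with hs | hs
      · rw [ext0_of_nonpos hs]
        exact lconvolution_of_nonpos (fun _ h => ext0_of_nonpos h) (fun _ h => ext0_of_nonpos h) hs
      · rw [ext0_of_pos hs]
    rw [hz, lintegral_Iio_ext0]
    refine ((setLIntegral_mono' measurableSet_Ioo fun s hs => hPmono hs.2.le).trans_lt ?_).ne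
    rw [setLIntegral_const, hconvI]
    exact ENNReal.mul_lt_top hPt.lt_top (by simp)
  have heq : (I ⋆ₗ P) t = (M + I ⋆ₗ N) t := le_antisymm
    (le_of_lintegral_Iio_eq hPmono hQmono hPlim hmain hfin)
    (le_of_lintegral_Iio_eq hQmono hPmono hQlim (fun s => (hmain s).symm) (by rwa [← hmain]))
  have hMt : M t = ∫⁻ τ in Ioi (0 : ℝ), cdfLt (μ τ) t := ext0_of_pos ht
  have hMfin : M t ≠ ⊤ := by
    rw [hMt]
    exact hμ.mean_ne_top one_pos (mul_pos one_pos (h.laplace_pos one_pos)) t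
  rw [Pi.add_apply, one_lconvolution, one_lconvolution] at heq
  have hreal := congrArg ENNReal.toReal heq
  rw [ENNReal.toReal_add hMfin hNt, hP, hN, lintegral_Iio_ext0, lintegral_Iio_ext0] at hreal
  rw [timeConv, intervalIntegral.integral_of_le ht.le, integral_Ioc_eq_integral_Ioo, ← hMt]
  simp only [one_mul]
  rw [integral_eq_lintegral_pos_part_sub_lintegral_neg_part hInt]
  linarith

end

/-! ### The measure `-w(t,dτ)` and the relaxation estimate -/

section

variable {k ℓ : ℝ → ℝ} {μ : ℝ → Measure ℝ≥0}

lemma IsSubordinator.exists_propagationMeasure_eq (hk : IsKernel k)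
    (h : IsSubordinator (fun p => p * laplace k p) μ) {t : ℝ} (ht : 0 < t) :
    ∃ hm : Monotone (fun τ : ℝ => -(cdfLt (μ τ) t).toReal),
      propagationMeasure k t = hm.stieltjesFunction.measure := by
  have hf : (fun τ : ℝ => -propagation k t (max τ 0)) = fun τ : ℝ => -(cdfLt (μ τ) t).toReal := by
    ext τ
    rw [h.propagation_eq hk (le_max_right τ 0) ht, h.max_zero]
  have hm : Monotone (fun τ : ℝ => -(cdfLt (μ τ) t).toReal) := fun a b hab =>
    neg_le_neg (ENNReal.toReal_mono (h.cdfLt_ne_top a t) (h.cdfLt_antitone t hab))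
  refine ⟨hm, ?_⟩
  have hm' : Monotone (fun τ : ℝ => -propagation k t (max τ 0)) := by rw [hf]; exact hm
  rw [propagationMeasure, dif_pos hm']
  congr

lemma isFiniteMeasure_propagationMeasure (hk : IsKernel k) {t : ℝ} (ht : 0 < t) :
    IsFiniteMeasure (propagationMeasure k t) := by
  obtain ⟨μ, h⟩ := hk.exists_isSubordinator
  obtain ⟨hm, heq⟩ := h.exists_propagationMeasure_eq hk ht
  rw [heq]
  set S := hm.stieltjesFunction with hS
  have hle : ∀ τ, S τ ≤ 0 := fun τ => by
    rw [hS, hm.stieltjesFunction_eq]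
    exact (hm.rightLim_le (lt_add_one τ)).trans (neg_nonpos.2 ENNReal.toReal_nonneg)
  have hge : ∀ τ, -1 ≤ S τ := fun τ => by
    rw [hS, hm.stieltjesFunction_eq]
    refine le_trans (neg_le_neg ?_) (hm.le_rightLim le_rfl)
    exact ENNReal.toReal_le_of_le_ofReal zero_le_one (by simpa using h.cdfLt_le_one τ t)
  refine ⟨?_⟩
  rw [S.measure_univ (tendsto_atBot_ciInf S.mono ⟨-1, by rintro _ ⟨τ, rfl⟩; exact hge τ⟩)
    (tendsto_atTop_ciSup S.mono ⟨0, by rintro _ ⟨τ, rfl⟩; exact hle τ⟩)]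
  exact ENNReal.ofReal_lt_top

/-- The relaxation estimate `∫ e^{-qτ} (-w(t,dτ)) ≤ 1 / (1 + q (1 * ℓ)(t))`. -/
theorem IsPC.lintegral_exp_propagationMeasure_le (hkl : IsPC k ℓ) {t : ℝ} (ht : 0 < t) :
    0 < timeConv (fun _ => 1) ℓ t ∧ ∀ q, 0 < q →
      ∫⁻ τ in Ioi (0 : ℝ), ENNReal.ofReal (Real.exp (-(q * τ))) ∂(propagationMeasure k t) ≤
        ENNReal.ofReal (1 / (1 + q * timeConv (fun _ => 1) ℓ t)) := by
  have hk := hkl.isKernel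
  obtain ⟨μ, h⟩ := hk.exists_isSubordinator
  have hLfin := h.mean_ne_top one_pos (mul_pos one_pos (hkl.laplace_pos one_pos)) t
  have hL := hkl.timeConv_one_eq h ht
  have hLpos : 0 < timeConv (fun _ => 1) ℓ t := by
    rw [hL]
    exact ENNReal.toReal_pos (hkl.mean_pos h ht) hLfin
  refine ⟨hLpos, fun q hq => ?_⟩
  have hfinm := isFiniteMeasure_propagationMeasure hk ht
  set m := propagationMeasure k t with hm_def
  obtain ⟨hm, heq⟩ := h.exists_propagationMeasure_eq hk ht
  set S := hm.stieltjesFunction with hS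
  let ν : Measure ℝ≥0 := (m.restrict (Ioi 0)).map Real.toNNReal
  have hs : ∫⁻ τ in Ioi (0 : ℝ), ENNReal.ofReal (Real.exp (-(q * τ))) ∂m = mlap ν q := by
    rw [mlap, lintegral_map (by fun_prop) (by fun_prop)]
    refine setLIntegral_congr_fun measurableSet_Ioi fun τ hτ => ?_
    rw [Real.coe_toNNReal _ (le_of_lt hτ)]
  -- The mass on `(0,b)` is `w(t,0) - w(t,b-)` up to regularization, and `w(t,0) ≤ 1`. Only
  -- inequalities are used, so right continuity of `w(t,·)` is not needed.
  have hcdf : ∀ b, 0 < b → cdfLt ν b + cdfLt (μ b) t ≤ 1 := by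
    intro b hb
    have h1 : cdfLt ν b = m (Ioo 0 b) := by
      rw [cdfLt, Measure.map_apply (by fun_prop) (measurableSet_coe_lt b),
        Measure.restrict_apply (measurable_real_toNNReal (measurableSet_coe_lt b))]
      congr 1
      ext x
      simp only [mem_inter_iff, mem_preimage, mem_ofPred_eq, mem_Ioi, mem_Ioo]
      constructor
      · rintro ⟨hx, hx0⟩
        exact ⟨hx0, by rwa [Real.coe_toNNReal _ hx0.le] at hx⟩
      · rintro ⟨hx0, hx⟩
        exact ⟨by rwa [Real.coe_toNNReal _ hx0.le], hx0⟩
    have hwb : (cdfLt (μ b) t).toReal ≤ 1 :=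
      ENNReal.toReal_le_of_le_ofReal zero_le_one (by simpa using h.cdfLt_le_one b t)
    have h2 : m (Ioo 0 b) ≤ ENNReal.ofReal (1 - (cdfLt (μ b) t).toReal) := by
      rw [hm_def, heq, S.measure_Ioo]
      refine ENNReal.ofReal_le_ofReal ?_
      have hl : Function.leftLim S b ≤ -(cdfLt (μ b) t).toReal := by
        refine le_of_tendsto (S.mono.tendsto_leftLim b) ?_
        filter_upwards [self_mem_nhdsWithin] with s hs
        rw [hS, hm.stieltjesFunction_eq]
        exact hm.rightLim_le hs
      have h0 : -1 ≤ S 0 := by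
        rw [hS, hm.stieltjesFunction_eq]
        refine le_trans (neg_le_neg ?_) (hm.le_rightLim le_rfl)
        exact ENNReal.toReal_le_of_le_ofReal zero_le_one (by simpa using h.cdfLt_le_one 0 t)
      linarith
    rw [h1]
    calc m (Ioo 0 b) + cdfLt (μ b) t
        ≤ ENNReal.ofReal (1 - (cdfLt (μ b) t).toReal) + ENNReal.ofReal (cdfLt (μ b) t).toReal := by
          rw [ENNReal.ofReal_toReal (h.cdfLt_ne_top b t)]
          gcongr
      _ = 1 := by
          rw [← ENNReal.ofReal_add (sub_nonneg.2 hwb) ENNReal.toReal_nonneg, sub_add_cancel,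
            ENNReal.ofReal_one]
  -- Integrate the previous bound against `q e^{-qb} db`; the first term becomes the transform of
  -- `ν` by parts.
  have hsA : mlap ν q + ENNReal.ofReal q * lap (fun τ => cdfLt (μ τ) t) q ≤ 1 := by
    rw [← ofReal_mul_lap_cdfLt ν hq, ← mul_add]
    have : lap (cdfLt ν) q + lap (fun τ => cdfLt (μ τ) t) q ≤ lap (fun _ => 1) q := by
      have hν := (cdfLt_mono ν).measurable
      rw [lap, lap, ← lintegral_add_left (by fun_prop)]
      refine setLIntegral_mono' measurableSet_Ioi fun b hb => ?_
      rw [← mul_add]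
      exact mul_le_mul_right (hcdf b hb) _
    refine (mul_le_mul_right this _).trans ?_
    rw [lap_one hq, ← ENNReal.ofReal_mul hq.le, mul_one_div_cancel hq.ne', ENNReal.ofReal_one]
  have hmean := h.mean_le hq t
  rw [hs]
  have hsfin : mlap ν q ≠ ⊤ := ((le_self_add.trans hsA).trans_lt ENNReal.one_lt_top).ne
  have hAfin : lap (fun τ => cdfLt (μ τ) t) q ≠ ⊤ := by
    intro htop
    rw [htop, ENNReal.mul_top (ENNReal.ofReal_pos.2 hq).ne', add_top] at hsA
    exact absurd hsA (by simp)
  rw [← ENNReal.ofReal_toReal hsfin, ← ENNReal.ofReal_toReal hAfin] at hsA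
  rw [← ENNReal.ofReal_toReal hAfin, ← ENNReal.ofReal_toReal hLfin, ← hL] at hmean
  rw [← ENNReal.ofReal_toReal hsfin]
  have hs0 : 0 ≤ (mlap ν q).toReal := ENNReal.toReal_nonneg
  have hA0 : 0 ≤ (lap (fun τ => cdfLt (μ τ) t) q).toReal := ENNReal.toReal_nonneg
  generalize (mlap ν q).toReal = s at *
  generalize (lap (fun τ => cdfLt (μ τ) t) q).toReal = A at *
  generalize timeConv (fun _ => 1) ℓ t = L at *
  rw [← ENNReal.ofReal_mul hq.le, ← ENNReal.ofReal_add hs0 (by positivity),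
    ENNReal.ofReal_le_one] at hsA
  rw [← ENNReal.ofReal_mul hq.le, ← ENNReal.ofReal_mul (by positivity),
    ← ENNReal.ofReal_add hA0 (by positivity), ENNReal.ofReal_le_ofReal_iff (by positivity)] at hmean
  refine ENNReal.ofReal_le_ofReal ?_
  rw [le_div_iff₀ (by positivity)]
  -- From `s ≤ 1 - qA` and `L ≤ A(1 + qL)`: `s(1 + qL) ≤ 1 + qL - qA(1 + qL) ≤ 1`.
  nlinarith [mul_pos hq hLpos]

end

/-! ### Plancherel's theorem for integrable functions -/

section Plancherel

variable {E : Type*} [NormedAddCommGroup E] [InnerProductSpace ℝ E] [FiniteDimensional ℝ E]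
  [MeasurableSpace E] [BorelSpace E]

lemma continuous_fourier_of_integrable {f : E → ℂ} (hf : Integrable f) : Continuous (𝓕 f) :=
  VectorFourier.fourierIntegral_continuous Real.continuous_fourierChar continuous_inner hf

lemma norm_fourier_le_integral (f : E → ℂ) (w : E) : ‖𝓕 f w‖ ≤ ∫ x, ‖f x‖ :=
  VectorFourier.norm_fourierIntegral_le_integral_norm _ _ _ _ _

lemma integral_fourier_mul_eq {f g : E → ℂ} (hf : Integrable f) (hg : Integrable g) :
    ∫ ξ, 𝓕 f ξ * g ξ = ∫ x, f x * 𝓕 g x := by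
  have := VectorFourier.integral_fourierIntegral_smul_eq_flip (L := innerₗ E)
    Real.continuous_fourierChar continuous_inner hf hg
  rw [flip_innerₗ] at this
  exact this

/-- Two locally integrable functions with the same integrals against Schwartz functions agree. -/
lemma ae_eq_of_integral_schwartz_eq {f g : E → ℂ} (hf : LocallyIntegrable f)
    (hg : LocallyIntegrable g) (h : ∀ φ : 𝓢(E, ℂ), ∫ x, φ x * f x = ∫ x, φ x * g x) :
    f =ᵐ[volume] g := by
  refine ae_eq_of_integral_contDiff_smul_eq hf hg fun φ hφ hc => ?_
  have hc' : HasCompactSupport (fun x => (φ x : ℂ)) := hc.comp_left Complex.ofReal_zero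
  have hφ' : ContDiff ℝ (⊤ : ℕ∞) (fun x => (φ x : ℂ)) := Complex.ofRealCLM.contDiff.comp hφ
  have := h (hc'.toSchwartzMap hφ')
  simpa only [Complex.real_smul, HasCompactSupport.toSchwartzMap_toFun] using this

/-- On `L₁ ∩ L₂` the `L₂`-Fourier transform is given by the Fourier integral. -/
theorem fourier_toLp_ae_eq {f : E → ℂ} (h1 : Integrable f) (h2 : MemLp f 2 volume) :
    (𝓕 (h2.toLp f) : Lp ℂ 2 (volume : Measure E)) =ᵐ[volume] 𝓕 f := by
  refine ae_eq_of_integral_schwartz_eq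
    ((Lp.memLp (𝓕 (h2.toLp f) : Lp ℂ 2 (volume : Measure E))).locallyIntegrable one_le_two)
    (continuous_fourier_of_integrable h1).locallyIntegrable fun φ => ?_
  have h3 : (𝓕 (Lp.toTemperedDistribution (h2.toLp f))) φ =
      (Lp.toTemperedDistribution (𝓕 (h2.toLp f) : Lp ℂ 2 (volume : Measure E))) φ := by
    rw [Lp.fourier_toTemperedDistribution_eq]
  rw [TemperedDistribution.fourier_apply, Lp.toTemperedDistribution_apply,
    Lp.toTemperedDistribution_apply] at h3
  simp only [smul_eq_mul] at h3
  have h4 : ∫ x, (𝓕 φ : 𝓢(E, ℂ)) x * h2.toLp f x = ∫ x, (𝓕 φ : 𝓢(E, ℂ)) x * f x :=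
    integral_congr_ae (h2.coeFn_toLp.mono fun x hx => by simp only [hx])
  rw [← h3, h4, SchwartzMap.fourier_coe, integral_fourier_mul_eq φ.integrable h1]

/-- Plancherel's theorem on `L₁ ∩ L₂`. -/
theorem memLp_fourier {f : E → ℂ} (h1 : Integrable f) (h2 : MemLp f 2 volume) :
    MemLp (𝓕 f) 2 volume :=
  (memLp_congr_ae (fourier_toLp_ae_eq h1 h2)).1 (Lp.memLp _)

/-- An integrable function whose Fourier transform is in `L₂` is itself in `L₂`, with the same
norm. -/
theorem memLp_of_fourier {f : E → ℂ} (h1 : Integrable f) (h2 : MemLp (𝓕 f) 2 volume) :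
    MemLp f 2 volume ∧ eLpNorm f 2 volume = eLpNorm (𝓕 f) 2 volume := by
  let G : Lp ℂ 2 (volume : Measure E) := h2.toLp (𝓕 f)
  let g : Lp ℂ 2 (volume : Measure E) := 𝓕⁻ G
  -- The `L₂` inverse transform of `𝓕 f` and `f` itself define the same tempered distribution.
  have hg : g =ᵐ[volume] f := by
    refine ae_eq_of_integral_schwartz_eq ((Lp.memLp g).locallyIntegrable one_le_two)
      h1.locallyIntegrable fun φ => ?_
    have h3 : (𝓕⁻ (Lp.toTemperedDistribution G)) φ = (Lp.toTemperedDistribution g) φ := by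
      rw [Lp.fourierInv_toTemperedDistribution_eq]
    rw [TemperedDistribution.fourierInv_apply, Lp.toTemperedDistribution_apply,
      Lp.toTemperedDistribution_apply] at h3
    simp only [smul_eq_mul] at h3
    have h5 : ∫ x, (𝓕⁻ φ : 𝓢(E, ℂ)) x * G x = ∫ x, (𝓕⁻ φ : 𝓢(E, ℂ)) x * 𝓕 f x :=
      integral_congr_ae (h2.coeFn_toLp.mono fun x hx => by simp only [G, hx])
    rw [← h3, h5]
    have h4 := integral_fourier_mul_eq h1 (𝓕⁻ φ).integrable
    rw [← SchwartzMap.fourier_coe, FourierTransform.fourier_fourierInv_eq] at h4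
    simpa only [mul_comm] using h4
  refine ⟨(memLp_congr_ae hg).1 (Lp.memLp g), ?_⟩
  rw [← eLpNorm_congr_ae hg, ← eLpNorm_congr_ae h2.coeFn_toLp, ← Lp.enorm_def, ← Lp.enorm_def]
  have hn : ‖g‖ = ‖G‖ := (Lp.fourierTransformₗᵢ E ℂ).symm.norm_map G
  rw [← ofReal_norm, ← ofReal_norm, hn]

end Plancherel

/-! ### The Schwartz functions `exp(-‖ξ‖^{2N})` -/

section ExpNegPow

variable {E : Type*} [NormedAddCommGroup E] [InnerProductSpace ℝ E]

lemma hasTemperateGrowth_norm_pow (N : ℕ) :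
    (fun x : E => -(‖x‖ ^ 2) ^ N).HasTemperateGrowth :=
  ((Function.hasTemperateGrowth_norm_sq E).pow N).neg

lemma exists_pow_mul_exp_neg_le {N : ℕ} (hN : 0 < N) (m : ℕ) :
    ∃ C : ℝ, ∀ r : ℝ, 0 ≤ r → (1 + r) ^ m * Real.exp (-(r ^ 2) ^ N) ≤ C := by
  have hcont : Continuous fun r : ℝ => (1 + r) ^ m * Real.exp (-(r ^ 2) ^ N) := by fun_prop
  have hlim : Tendsto (fun r : ℝ => (1 + r) ^ m * Real.exp (-(r ^ 2) ^ N)) atTop (𝓝 0) := by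
    have h1 : Tendsto (fun r : ℝ => (1 + r) ^ m * Real.exp (-(1 + r)) * Real.exp 1) atTop
        (𝓝 (0 * Real.exp 1)) :=
      ((Real.tendsto_pow_mul_exp_neg_atTop_nhds_zero m).comp
        (tendsto_atTop_add_const_left _ 1 tendsto_id)).mul_const _
    rw [zero_mul] at h1
    refine squeeze_zero' ?_ ?_ h1
    · filter_upwards [eventually_ge_atTop 0] with r hr
      positivity
    · filter_upwards [eventually_ge_atTop 1] with r hr
      rw [mul_assoc, ← Real.exp_add]
      gcongr
      have : r ≤ (r ^ 2) ^ N := by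
        rw [← pow_mul]
        exact le_self_pow₀ hr (by positivity)
      linarith
  obtain ⟨R, hR⟩ := (hlim.eventually_le_const one_pos).exists_forall_of_atTop
  obtain ⟨C, hC⟩ := (isCompact_Icc (a := (0 : ℝ)) (b := R)).bddAbove_image hcont.continuousOn
  refine ⟨max C 1, fun r hr => ?_⟩
  rcases le_total r R with h | h
  · exact (hC ⟨r, ⟨hr, h⟩, rfl⟩).trans (le_max_left _ _)
  · exact (hR r h).trans (le_max_right _ _)

/-- The Schwartz function `ξ ↦ exp(-‖ξ‖^{2N})`. -/
def expNegPow (E : Type*) [NormedAddCommGroup E] [InnerProductSpace ℝ E] (N : ℕ) (hN : 0 < N) :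
    𝓢(E, ℝ) where
  toFun x := Real.exp (-(‖x‖ ^ 2) ^ N)
  smooth' := Real.contDiff_exp.comp (hasTemperateGrowth_norm_pow N).1
  decay' k n := by
    obtain ⟨a, C, hC, hbound⟩ :=
      (hasTemperateGrowth_norm_pow (E := E) N).norm_iteratedFDeriv_le_uniform n
    set D : ℝ := max C 1 with hD
    obtain ⟨B, hB⟩ := exists_pow_mul_exp_neg_le hN (k + a * n)
    refine ⟨n.factorial * D ^ n * B, fun x => ?_⟩
    have h1 : ∀ i ≤ n, ‖iteratedFDeriv ℝ i Real.exp (-(‖x‖ ^ 2) ^ N)‖ ≤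
        Real.exp (-(‖x‖ ^ 2) ^ N) := by
      intro i _
      rw [norm_iteratedFDeriv_eq_norm_iteratedDeriv, iteratedDeriv_eq_iterate, Real.iter_deriv_exp,
        Real.norm_eq_abs, Real.abs_exp]
    have hx1 : 1 ≤ (1 + ‖x‖) ^ a := one_le_pow₀ (by linarith [norm_nonneg x])
    have hD1 : 1 ≤ D := le_max_right _ _
    have h2 : ∀ i, 1 ≤ i → i ≤ n → ‖iteratedFDeriv ℝ i (fun x : E => -(‖x‖ ^ 2) ^ N) x‖ ≤
        (D * (1 + ‖x‖) ^ a) ^ i := by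
      intro i hi1 hi
      calc _ ≤ C * (1 + ‖x‖) ^ a := hbound i hi x
        _ ≤ D * (1 + ‖x‖) ^ a := by
            gcongr
            exact le_max_left _ _
        _ ≤ _ := le_self_pow₀ (one_le_mul_of_one_le_of_one_le hD1 hx1) (by omega)
    have h3 := norm_iteratedFDeriv_comp_le (Real.contDiff_exp (n := (⊤ : ℕ∞)))
      (hasTemperateGrowth_norm_pow (E := E) N).1 (by exact_mod_cast le_top) x h1 h2
    calc ‖x‖ ^ k * ‖iteratedFDeriv ℝ n (fun x : E => Real.exp (-(‖x‖ ^ 2) ^ N)) x‖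
        ≤ (1 + ‖x‖) ^ k * (n.factorial * Real.exp (-(‖x‖ ^ 2) ^ N) * (D * (1 + ‖x‖) ^ a) ^ n) := by
          gcongr
          · linarith
          · exact h3
      _ = n.factorial * D ^ n * ((1 + ‖x‖) ^ (k + a * n) * Real.exp (-(‖x‖ ^ 2) ^ N)) := by
          rw [pow_add, pow_mul, mul_pow]
          ring
      _ ≤ _ := by
          gcongr
          exact hB _ (norm_nonneg x)

end ExpNegPow

/-! ### Stable subordination and the uniform `L₁` bound -/

/-- The kernel `t^{-α}/Γ(1-α)`, whose subordinator is the one-sided `α`-stable one. -/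
lemma isKernel_stable {α : ℝ} (h0 : 0 < α) (h1 : α < 1) :
    IsKernel fun t => t ^ (-α) / Real.Gamma (1 - α) := by
  have hΓ : 0 < Real.Gamma (1 - α) := Real.Gamma_pos_of_pos (by linarith)
  refine ⟨fun T hT => ?_, fun t ht => by positivity, fun s hs t ht hst => ?_⟩
  · have := (intervalIntegral.intervalIntegrable_rpow' (a := 0) (b := T) (r := -α)
      (by linarith)).div_const (Real.Gamma (1 - α))
    rwa [intervalIntegrable_iff_integrableOn_Ioc_of_le hT.le] at this
  · gcongr ?_ / _
    exact Real.rpow_le_rpow_of_nonpos hs hst (by linarith)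

lemma laplace_stable {α p : ℝ} (h1 : α < 1) (hp : 0 < p) :
    p * laplace (fun t => t ^ (-α) / Real.Gamma (1 - α)) p = p ^ α := by
  have hΓ : 0 < Real.Gamma (1 - α) := Real.Gamma_pos_of_pos (by linarith)
  have h := Real.integral_rpow_mul_exp_neg_mul_Ioi (a := 1 - α) (r := p) (by linarith) hp
  have h2 : laplace (fun t => t ^ (-α) / Real.Gamma (1 - α)) p =
      (∫ t in Ioi (0 : ℝ), t ^ (1 - α - 1) * Real.exp (-(p * t))) / Real.Gamma (1 - α) := by
    rw [laplace, ← integral_div]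
    refine setIntegral_congr_fun measurableSet_Ioi fun t _ => ?_
    have : (1 - α - 1) = -α := by ring
    simp only [this]
    ring
  rw [h2, h, mul_div_cancel_right₀ _ hΓ.ne', one_div, Real.inv_rpow hp.le, ← Real.rpow_neg hp.le]
  nth_rw 1 [← Real.rpow_one p]
  rw [← Real.rpow_add hp]
  congr 1
  ring

/-- One-sided stable laws. -/
lemma exists_mlap_stable {α c : ℝ} (h0 : 0 < α) (h1 : α < 1) (hc : 0 ≤ c) :
    ∃ σ : Measure ℝ≥0, σ univ ≤ 1 ∧
      ∀ p, 0 < p → mlap σ p = ENNReal.ofReal (Real.exp (-(c * p ^ α))) := by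
  obtain ⟨σ, hσ1, hσ⟩ := exists_mlap_of_isKernel (isKernel_stable h0 h1) hc
  refine ⟨σ, hσ1, fun p hp => ?_⟩
  rw [hσ p hp, laplace_stable h1 hp]

/-- The symbol `exp(-τ ‖2πζ‖^ρ)` in the frequency variable of the Fourier transform `𝓕`. -/
def heatSymbol (E : Type*) [NormedAddCommGroup E] (ρ τ : ℝ) (ζ : E) : ℂ :=
  ((Real.exp (-(τ * (2 * Real.pi * ‖ζ‖) ^ ρ)) : ℝ) : ℂ)

lemma continuous_heatSymbol {E : Type*} [NormedAddCommGroup E] {ρ : ℝ} (hρ : 0 < ρ)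
    (τ : ℝ) : Continuous (heatSymbol E ρ τ) := by
  unfold heatSymbol
  have : Continuous fun ζ : E => (2 * Real.pi * ‖ζ‖) ^ ρ :=
    (by fun_prop : Continuous fun ζ : E => 2 * Real.pi * ‖ζ‖).rpow_const fun _ => Or.inr hρ.le
  fun_prop

section

variable {E : Type*} [NormedAddCommGroup E] [InnerProductSpace ℝ E] [FiniteDimensional ℝ E]
  [MeasurableSpace E] [BorelSpace E]

lemma fourierInv_comp_smul (g : E → ℂ) {c : ℝ} (hc : 0 < c) (x : E) :
    𝓕⁻ (fun ξ => g (c • ξ)) x = |(c ^ Module.finrank ℝ E)⁻¹| • 𝓕⁻ g (c⁻¹ • x) := by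
  rw [Real.fourierInv_eq', Real.fourierInv_eq', ← Measure.integral_comp_smul]
  refine integral_congr_ae (ae_of_all _ fun v => ?_)
  simp only
  rw [real_inner_smul_left, real_inner_smul_right, mul_inv_cancel_left₀ hc.ne']

/-- Dilating the symbol by `c` turns the kernel into an `L₁`-normalized dilate, so all
`exp(-s‖ξ‖^{2N})` with `s > 0` have kernels of the same `L₁` norm. -/
lemma lintegral_enorm_fourierInv_comp_smul {g : E → ℂ} (hg : Integrable (𝓕⁻ g)) {c : ℝ}
    (hc : 0 < c) :
    ∫⁻ x, ‖𝓕⁻ (fun ξ => g (c • ξ)) x‖ₑ = ∫⁻ x, ‖𝓕⁻ g x‖ₑ := by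
  have hi : Integrable fun x => |(c ^ Module.finrank ℝ E)⁻¹| • 𝓕⁻ g (c⁻¹ • x) :=
    (hg.comp_smul (inv_ne_zero hc.ne')).smul |(c ^ Module.finrank ℝ E)⁻¹|
  simp only [fourierInv_comp_smul g hc]
  rw [← ofReal_integral_norm_eq_lintegral_enorm hi, ← ofReal_integral_norm_eq_lintegral_enorm hg]
  congr 1
  simp only [norm_smul, Real.norm_eq_abs, abs_abs]
  rw [integral_const_mul, Measure.integral_comp_smul volume (fun x => ‖𝓕⁻ g x‖) c⁻¹, smul_eq_mul,
    ← mul_assoc, ← abs_mul, inv_pow, inv_inv, inv_mul_cancel₀ (by positivity), abs_one, one_mul]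

/-- The symbol `exp(-s ‖ξ‖^{2N})` as a complex function. -/
def powSymbol (E : Type*) [NormedAddCommGroup E] (N : ℕ) (s : ℝ) (ξ : E) : ℂ :=
  ((Real.exp (-(s * (‖ξ‖ ^ 2) ^ N)) : ℝ) : ℂ)

lemma integrable_fourierInv_powSymbol {N : ℕ} (hN : 0 < N) :
    Integrable (𝓕⁻ (powSymbol E N 1)) := by
  let φ : 𝓢(E, ℂ) := (expNegPow E N hN).postcompCLM Complex.ofRealCLM
  have h : powSymbol E N 1 = φ := by
    ext ξ
    simp only [powSymbol, one_mul]
    rfl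
  rw [h, ← SchwartzMap.fourierInv_coe]
  exact (𝓕⁻ φ).integrable

/-- The kernels with symbols `exp(-s ‖ξ‖^{2N})` are bounded in `L₁`, uniformly in `s`. -/
lemma exists_lintegral_fourierInv_powSymbol_le [Nontrivial E] {N : ℕ} (hN : 0 < N) :
    ∃ C : ℝ≥0∞, C ≠ ⊤ ∧ ∀ s : ℝ, 0 ≤ s → ∫⁻ x, ‖𝓕⁻ (powSymbol E N s) x‖ₑ ≤ C := by
  have hInt := integrable_fourierInv_powSymbol (E := E) hN
  refine ⟨∫⁻ x, ‖𝓕⁻ (powSymbol E N 1) x‖ₑ, hInt.2.ne, fun s hs => ?_⟩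
  rcases hs.eq_or_lt with rfl | hs
  -- The constant symbol `1` is not integrable on a nontrivial space, so its Fourier integral takes
  -- the default value `0`. The case is included because an atom at `0` of the mixing measure has
  -- not been excluded.
  · have hz : ∀ x, 𝓕⁻ (powSymbol E N 0) x = 0 := by
      intro x
      rw [Real.fourierInv_eq']
      refine integral_undef fun hi => ?_
      have hn := hi.norm
      have h1 : (fun v : E => ‖Complex.exp (((2 * Real.pi * inner ℝ v x : ℝ) : ℂ) * Complex.I) •
          powSymbol E N 0 v‖) = fun _ => (1 : ℝ) := by
        ext v
        rw [norm_smul, Complex.norm_exp_ofReal_mul_I]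
        simp [powSymbol]
      rw [h1, integrable_const_iff] at hn
      rcases hn with h | h
      · exact one_ne_zero h
      · exact (h.measure_univ_lt_top (μ := (volume : Measure E))).ne
          (measure_univ_of_isAddLeftInvariant _)
    simp [hz]
  · set c : ℝ := s ^ ((1 : ℝ) / (2 * N)) with hc
    have hc0 : 0 < c := Real.rpow_pos_of_pos hs _
    have hcN : (c ^ 2) ^ N = s := by
      rw [← pow_mul, hc, ← Real.rpow_natCast, ← Real.rpow_mul hs.le]
      push_cast
      rw [one_div, inv_mul_cancel₀ (by positivity), Real.rpow_one]
    have h : powSymbol E N s = fun ξ => powSymbol E N 1 (c • ξ) := by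
      ext ξ
      simp only [powSymbol]
      rw [norm_smul, Real.norm_of_nonneg hc0.le, mul_pow, mul_pow, hcN, one_mul]
    rw [h, lintegral_enorm_fourierInv_comp_smul hInt hc0]

lemma integrable_heatSymbol [Nontrivial E] {ρ τ : ℝ} (hρ : 0 < ρ) (hτ : 0 < τ) :
    Integrable (heatSymbol E ρ τ) := by
  have h := integrable_fun_norm_addHaar (E := E) volume
    (f := fun r => Real.exp (-(τ * (2 * Real.pi * r) ^ ρ)))
  refine Integrable.ofReal (h.2 ?_)
  have hb : 0 < τ * (2 * Real.pi) ^ ρ := by positivity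
  have hs : (-1 : ℝ) < (Module.finrank ℝ E - 1 : ℕ) := by
    have : (0 : ℝ) ≤ (Module.finrank ℝ E - 1 : ℕ) := Nat.cast_nonneg _
    linarith
  refine (integrableOn_rpow_mul_exp_neg_mul_rpow hs hρ hb).congr_fun (fun r hr => ?_)
    measurableSet_Ioi
  simp only [smul_eq_mul]
  rw [Real.rpow_natCast, Real.mul_rpow (by positivity) (le_of_lt hr)]
  congr 2
  ring

/-- Subordination: the kernels with symbols `exp(-τ ‖2πζ‖^ρ)` are bounded in `L₁`, uniformly
in `τ`. -/
theorem exists_lintegral_fourierInv_heatSymbol_le [Nontrivial E] {ρ : ℝ} (hρ : 0 < ρ) :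
    ∃ C : ℝ≥0∞, C ≠ ⊤ ∧ ∀ τ : ℝ, 0 < τ → ∫⁻ x, ‖𝓕⁻ (heatSymbol E ρ τ) x‖ₑ ≤ C := by
  obtain ⟨N, hN⟩ := exists_nat_gt ρ
  have hN0 : 0 < N := by
    have : (0 : ℝ) < N := hρ.trans hN
    exact_mod_cast this
  have hNR : (0 : ℝ) < N := by exact_mod_cast hN0
  obtain ⟨C, hC, hCle⟩ := exists_lintegral_fourierInv_powSymbol_le (E := E) hN0
  refine ⟨C, hC, fun τ hτ => ?_⟩
  -- With `α = ρ/(2N) < 1`, evaluating the stable law at `p = ‖ζ‖^{2N}` gives `exp(-τ (2π)^ρ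
  -- ‖ζ‖^ρ)`, which is the heat symbol.
  obtain ⟨σ, hσ1, hσ⟩ := exists_mlap_stable (α := ρ / (2 * N)) (c := τ * (2 * Real.pi) ^ ρ)
    (by positivity) (by rw [div_lt_one (by positivity)]; linarith) (by positivity)
  have : IsFiniteMeasure σ := ⟨hσ1.trans_lt ENNReal.one_lt_top⟩
  have hle1 : ∀ (ζ : E) (s : ℝ≥0), ‖powSymbol E N s ζ‖ ≤ 1 := by
    intro ζ s
    rw [powSymbol, Complex.norm_real, Real.norm_eq_abs, Real.abs_exp, Real.exp_le_one_iff]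
    have : 0 ≤ (s : ℝ) * (‖ζ‖ ^ 2) ^ N := by positivity
    linarith
  have hcont : Continuous fun z : E × ℝ≥0 => powSymbol E N z.2 z.1 := by
    unfold powSymbol
    fun_prop
  have hInt1 : ∀ ζ : E, Integrable (fun s : ℝ≥0 => powSymbol E N s ζ) σ := fun ζ =>
    Integrable.of_bound (C := 1)
      (hcont.comp (by fun_prop : Continuous fun s : ℝ≥0 => (ζ, s))).aestronglyMeasurable
      (ae_of_all _ fun s => hle1 ζ s)
  have hreal : ∀ ζ : E, ζ ≠ 0 → ∫ s : ℝ≥0, Real.exp (-(s * (‖ζ‖ ^ 2) ^ N)) ∂σ =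
      Real.exp (-(τ * (2 * Real.pi * ‖ζ‖) ^ ρ)) := by
    intro ζ hζ
    have hζ' : 0 < ‖ζ‖ := norm_pos_iff.2 hζ
    have h := hσ ((‖ζ‖ ^ 2) ^ N) (by positivity)
    rw [integral_eq_lintegral_of_nonneg_ae (ae_of_all _ fun _ => (Real.exp_pos _).le)
      (by fun_prop)]
    simp only [mlap, mul_comm ((‖ζ‖ ^ 2) ^ N)] at h
    rw [h, ENNReal.toReal_ofReal (Real.exp_pos _).le, Real.mul_rpow (by positivity) hζ'.le,
      ← pow_mul, ← Real.rpow_natCast, ← Real.rpow_mul hζ'.le, mul_assoc]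
    congr 5
    push_cast
    field_simp
  have hsub : ∀ ζ : E, ζ ≠ 0 → heatSymbol E ρ τ ζ = ∫ s : ℝ≥0, powSymbol E N s ζ ∂σ := by
    intro ζ hζ
    simp only [powSymbol]
    rw [integral_complex_ofReal, hreal ζ hζ]
    rfl
  have hne : ∀ᵐ ζ : E, ζ ≠ 0 := Measure.ae_ne volume 0
  -- The symbols are positive, so integrating their norms over `s` gives back the heat symbol, which
  -- is integrable in `ζ`.
  have hF : Integrable (fun z : E × ℝ≥0 => powSymbol E N z.2 z.1) (volume.prod σ) := by
    rw [integrable_prod_iff hcont.aestronglyMeasurable]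
    refine ⟨ae_of_all _ hInt1, (integrable_heatSymbol (E := E) hρ hτ).norm.congr ?_⟩
    filter_upwards [hne] with ζ hζ
    simp only [powSymbol, heatSymbol, Complex.norm_real, Real.norm_eq_abs, Real.abs_exp]
    exact (hreal ζ hζ).symm
  have hrep : ∀ x, 𝓕⁻ (heatSymbol E ρ τ) x = ∫ s : ℝ≥0, 𝓕⁻ (powSymbol E N s) x ∂σ := by
    intro x
    simp only [Real.fourierInv_eq']
    rw [← integral_integral_swap]
    · refine integral_congr_ae ?_
      filter_upwards [hne] with ζ hζ
      rw [hsub ζ hζ, integral_smul]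
    · refine hF.mono ?_ (ae_of_all _ fun z => ?_)
      · refine Continuous.aestronglyMeasurable ?_
        simp only [Function.uncurry_def]
        exact Continuous.smul (by fun_prop : Continuous fun z : E × ℝ≥0 =>
          Complex.exp (((2 * Real.pi * inner ℝ z.1 x : ℝ) : ℂ) * Complex.I)) hcont
      · simp only [Function.uncurry_def]
        rw [norm_smul, Complex.norm_exp_ofReal_mul_I, one_mul]
  have hmeas : StronglyMeasurable fun z : E × ℝ≥0 => 𝓕⁻ (powSymbol E N z.2) z.1 := by
    simp only [Real.fourierInv_eq']
    refine StronglyMeasurable.integral_prod_right' (f := fun y : (E × ℝ≥0) × E =>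
      Complex.exp (((2 * Real.pi * inner ℝ y.2 y.1.1 : ℝ) : ℂ) * Complex.I) •
        powSymbol E N y.1.2 y.2) (Continuous.stronglyMeasurable ?_)
    exact Continuous.smul (by fun_prop : Continuous fun y : (E × ℝ≥0) × E =>
        Complex.exp (((2 * Real.pi * inner ℝ y.2 y.1.1 : ℝ) : ℂ) * Complex.I))
      (hcont.comp (by fun_prop : Continuous fun y : (E × ℝ≥0) × E => (y.2, y.1.2)))
  calc ∫⁻ x, ‖𝓕⁻ (heatSymbol E ρ τ) x‖ₑ
      ≤ ∫⁻ x, ∫⁻ s : ℝ≥0, ‖𝓕⁻ (powSymbol E N s) x‖ₑ ∂σ := by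
        refine lintegral_mono fun x => ?_
        rw [hrep x]
        exact enorm_integral_le_lintegral_enorm _
    _ = ∫⁻ s : ℝ≥0, (∫⁻ x, ‖𝓕⁻ (powSymbol E N s) x‖ₑ) ∂σ :=
        lintegral_lintegral_swap hmeas.enorm.aemeasurable
    _ ≤ ∫⁻ _ : ℝ≥0, C ∂σ := lintegral_mono fun s => hCle s s.2
    _ ≤ C := by
        rw [lintegral_const]
        exact mul_le_of_le_one_right' hσ1

end

/-! ### The kernel `η^ρ_τ` and its Fourier transform -/

section eta

variable {d : ℕ} {ρ : ℝ}

lemma eta_eq_fourierInv (d : ℕ) (ρ τ : ℝ) (x : EuclideanSpace ℝ (Fin d)) :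
    eta d ρ τ x = 𝓕⁻ (heatSymbol (EuclideanSpace ℝ (Fin d)) ρ τ) x := by
  have h := Measure.integral_comp_smul (volume : Measure (EuclideanSpace ℝ (Fin d)))
    (fun ξ => Complex.exp (Complex.I * ((inner ℝ x ξ : ℝ) : ℂ)) *
      ((Real.exp (-(τ * ‖ξ‖ ^ ρ)) : ℝ) : ℂ)) (2 * Real.pi)
  rw [finrank_euclideanSpace_fin, abs_of_nonneg (by positivity), Complex.real_smul,
    Complex.ofReal_inv] at h
  rw [eta, ← h, Real.fourierInv_eq']
  refine integral_congr_ae (ae_of_all _ fun ζ => ?_)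
  simp only [heatSymbol, smul_eq_mul]
  rw [norm_smul, Real.norm_of_nonneg (by positivity), real_inner_smul_right, real_inner_comm,
    mul_comm Complex.I]

lemma stronglyMeasurable_eta (d : ℕ) {ρ : ℝ} (hρ : 0 < ρ) :
    StronglyMeasurable fun z : EuclideanSpace ℝ (Fin d) × ℝ => eta d ρ z.2 z.1 := by
  unfold eta
  refine StronglyMeasurable.const_mul (StronglyMeasurable.integral_prod_right'
    (f := fun y : (EuclideanSpace ℝ (Fin d) × ℝ) × EuclideanSpace ℝ (Fin d) =>
      Complex.exp (Complex.I * ((inner ℝ y.1.1 y.2 : ℝ) : ℂ)) *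
        ((Real.exp (-(y.1.2 * ‖y.2‖ ^ ρ)) : ℝ) : ℂ)) (Continuous.stronglyMeasurable ?_)) _
  have : Continuous fun y : (EuclideanSpace ℝ (Fin d) × ℝ) × EuclideanSpace ℝ (Fin d) =>
      ‖y.2‖ ^ ρ :=
    (by fun_prop : Continuous fun y : (EuclideanSpace ℝ (Fin d) × ℝ) × EuclideanSpace ℝ (Fin d) =>
      ‖y.2‖).rpow_const fun _ => Or.inr hρ.le
  fun_prop

theorem exists_lintegral_eta_le (hd : 0 < d) (hρ : 0 < ρ) :
    ∃ C : ℝ≥0∞, C ≠ ⊤ ∧ ∀ τ : ℝ, 0 < τ → ∫⁻ x, ‖eta d ρ τ x‖ₑ ≤ C := by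
  have : Nonempty (Fin d) := ⟨⟨0, hd⟩⟩
  simp only [eta_eq_fourierInv]
  exact exists_lintegral_fourierInv_heatSymbol_le hρ

lemma integrable_eta (hd : 0 < d) (hρ : 0 < ρ) {τ : ℝ} (hτ : 0 < τ) : Integrable (eta d ρ τ) := by
  obtain ⟨C, hC, hle⟩ := exists_lintegral_eta_le hd hρ
  refine ⟨((stronglyMeasurable_eta d hρ).comp_measurable
    (by fun_prop : Measurable fun x : EuclideanSpace ℝ (Fin d) => (x, τ))).aestronglyMeasurable, ?_⟩
  exact (hle τ hτ).trans_lt hC.lt_top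

theorem fourier_eta (hd : 0 < d) (hρ : 0 < ρ) {τ : ℝ} (hτ : 0 < τ) :
    𝓕 (eta d ρ τ) = heatSymbol (EuclideanSpace ℝ (Fin d)) ρ τ := by
  have : Nonempty (Fin d) := ⟨⟨0, hd⟩⟩
  have h : eta d ρ τ = 𝓕⁻ (heatSymbol (EuclideanSpace ℝ (Fin d)) ρ τ) :=
    funext fun x => eta_eq_fourierInv d ρ τ x
  have hi := integrable_eta hd hρ hτ
  rw [h] at hi ⊢
  refine (continuous_heatSymbol hρ τ).fourier_fourierInv_eq (integrable_heatSymbol hρ hτ) ?_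
  refine hi.comp_neg.congr (ae_of_all _ fun x => ?_)
  simp only [Real.fourierInv_eq_fourier_neg, neg_neg]

end eta

/-! ### Two radial integrals -/

section radial

variable {E : Type*} [NormedAddCommGroup E] [InnerProductSpace ℝ E] [FiniteDimensional ℝ E]
  [MeasurableSpace E] [BorelSpace E] [Nontrivial E]

/-- Homogeneous singularities of order less than the dimension are integrable near the origin. -/
lemma integrable_indicator_norm_rpow {a : ℝ} (ha : a < Module.finrank ℝ E) :
    Integrable fun x : E => indicator (Iic (1 : ℝ)) (fun r => r ^ (-a)) ‖x‖ := by
  rw [integrable_fun_norm_addHaar (E := E) volume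
    (f := indicator (Iic (1 : ℝ)) (fun r => r ^ (-a)))]
  have hd : 0 < Module.finrank ℝ E := Module.finrank_pos
  have hcast : ((Module.finrank ℝ E - 1 : ℕ) : ℝ) = Module.finrank ℝ E - 1 := by
    rw [Nat.cast_sub hd, Nat.cast_one]
  have h := (intervalIntegral.intervalIntegrable_rpow' (a := 0) (b := 1)
    (r := ((Module.finrank ℝ E - 1 : ℕ) : ℝ) + -a) (by rw [hcast]; linarith))
  rw [intervalIntegrable_iff_integrableOn_Ioc_of_le zero_le_one] at h
  have h2 : IntegrableOn (indicator (Iic (1 : ℝ))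
      fun y => y ^ (((Module.finrank ℝ E - 1 : ℕ) : ℝ) + -a)) (Ioi 0) := by
    rw [IntegrableOn, integrable_indicator_iff measurableSet_Iic, IntegrableOn,
      Measure.restrict_restrict measurableSet_Iic, Iic_inter_Ioi]
    exact h
  refine h2.congr_fun (fun y hy => ?_) measurableSet_Ioi
  by_cases h1 : y ≤ 1
  · simp only [indicator_of_mem (mem_Iic.2 h1), smul_eq_mul]
    rw [Real.rpow_add hy, Real.rpow_natCast]
  · simp only [indicator_of_notMem (notMem_Iic.2 (not_le.1 h1)), smul_zero]

/-- `(1 + (b‖x‖)^ρ)^{-1}` is square integrable if `2ρ` exceeds the dimension. -/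
lemma integrable_inv_one_add_norm_rpow_sq {ρ b : ℝ} (hb : 0 < b)
    (hρ : (Module.finrank ℝ E : ℝ) < 2 * ρ) :
    Integrable fun x : E => (1 / (1 + (b * ‖x‖) ^ ρ)) ^ 2 := by
  have hd : 0 < Module.finrank ℝ E := Module.finrank_pos
  have hcast : ((Module.finrank ℝ E - 1 : ℕ) : ℝ) = Module.finrank ℝ E - 1 := by
    rw [Nat.cast_sub hd, Nat.cast_one]
  rw [integrable_fun_norm_addHaar (E := E) volume (f := fun r => (1 / (1 + (b * r) ^ ρ)) ^ 2)]
  have hmeas : Measurable fun y : ℝ =>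
      y ^ (Module.finrank ℝ E - 1) • (1 / (1 + (b * y) ^ ρ)) ^ 2 := by
    simp only [smul_eq_mul]
    fun_prop
  rw [← Ioc_union_Ioi_eq_Ioi (zero_le_one' ℝ)]
  refine IntegrableOn.union ?_ ?_
  · refine Integrable.of_bound (C := 1) hmeas.aestronglyMeasurable ?_
    filter_upwards [ae_restrict_mem measurableSet_Ioc] with y hy
    have h0 : 0 ≤ (b * y) ^ ρ := Real.rpow_nonneg (mul_nonneg hb.le hy.1.le) _
    rw [Real.norm_eq_abs, smul_eq_mul, abs_of_nonneg
      (mul_nonneg (pow_nonneg hy.1.le _) (sq_nonneg _))]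
    refine mul_le_one₀ (pow_le_one₀ hy.1.le hy.2) (sq_nonneg _) (pow_le_one₀ (by positivity) ?_)
    rw [div_le_one (by positivity)]
    linarith
  · have hi := (integrableOn_Ioi_rpow_of_lt
      (a := ((Module.finrank ℝ E - 1 : ℕ) : ℝ) + -(2 * ρ)) (by rw [hcast]; linarith)
      one_pos).const_mul (b ^ (-(2 * ρ)))
    refine Integrable.mono' hi hmeas.aestronglyMeasurable ?_
    filter_upwards [ae_restrict_mem measurableSet_Ioi] with y hy
    have hy0 : 0 < y := one_pos.trans hy
    have hby : 0 < (b * y) ^ ρ := Real.rpow_pos_of_pos (mul_pos hb hy0) _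
    rw [Real.norm_eq_abs, smul_eq_mul, abs_of_nonneg (by positivity), Real.rpow_add hy0,
      Real.rpow_natCast, mul_left_comm, ← Real.mul_rpow hb.le hy0.le]
    gcongr
    have h2 : (b * y) ^ (-(2 * ρ)) = (1 / (b * y) ^ ρ) ^ 2 := by
      rw [one_div, ← Real.rpow_neg (by positivity), ← Real.rpow_natCast,
        ← Real.rpow_mul (by positivity)]
      congr 1
      push_cast
      ring
    rw [h2]
    gcongr
    linarith

end radial

/-! ### Fourier bounds and decay of the mild solution -/

section solution

variable {d : ℕ} {ρ : ℝ} {k ℓ : ℝ → ℝ} {u₀ : EuclideanSpace ℝ (Fin d) → ℂ} {t : ℝ}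

/-- The uniform `L₁` bound together with the finite mass of `m`. It yields both the convergence of
the integral defining `Z` and the Fubini step for its Fourier transform. -/
lemma integrable_eta_prod (hd : 0 < d) (hρ : 0 < ρ) (m : Measure ℝ) [IsFiniteMeasure m] :
    Integrable (fun z : EuclideanSpace ℝ (Fin d) × ℝ => eta d ρ z.2 z.1)
      (volume.prod (m.restrict (Ioi 0))) := by
  obtain ⟨C, hC, hle⟩ := exists_lintegral_eta_le hd hρ
  refine ⟨(stronglyMeasurable_eta d hρ).aestronglyMeasurable, ?_⟩
  rw [HasFiniteIntegral, lintegral_prod_symm _ (stronglyMeasurable_eta d hρ).enorm.aemeasurable]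
  calc ∫⁻ τ in Ioi (0 : ℝ), (∫⁻ x, ‖eta d ρ τ x‖ₑ) ∂m
      ≤ ∫⁻ _ in Ioi (0 : ℝ), C ∂m := setLIntegral_mono' measurableSet_Ioi fun τ hτ => hle τ hτ
    _ < ⊤ := by
        rw [setLIntegral_const]
        exact ENNReal.mul_lt_top hC.lt_top (measure_lt_top _ _)

lemma integrable_fundamentalSolution (hd : 0 < d) (hρ : 0 < ρ) (hk : IsKernel k) (ht : 0 < t) :
    Integrable (fundamentalSolution d ρ k t) := by
  have := isFiniteMeasure_propagationMeasure hk ht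
  exact (integrable_eta_prod hd hρ (propagationMeasure k t)).integral_prod_left

/-- The Fourier transform of the fundamental solution is the relaxation function of the symbol. -/
lemma fourier_fundamentalSolution (hd : 0 < d) (hρ : 0 < ρ) (hk : IsKernel k) (ht : 0 < t)
    (ζ : EuclideanSpace ℝ (Fin d)) :
    𝓕 (fundamentalSolution d ρ k t) ζ =
      ∫ τ in Ioi (0 : ℝ),
        heatSymbol (EuclideanSpace ℝ (Fin d)) ρ τ ζ ∂(propagationMeasure k t) := by
  have := isFiniteMeasure_propagationMeasure hk ht
  have hInt := integrable_eta_prod hd hρ (propagationMeasure k t)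
  have h1 : ∀ τ ∈ Ioi (0 : ℝ), heatSymbol (EuclideanSpace ℝ (Fin d)) ρ τ ζ =
      ∫ x, Complex.exp (((-2 * Real.pi * inner ℝ x ζ : ℝ) : ℂ) * Complex.I) • eta d ρ τ x := by
    intro τ hτ
    rw [← fourier_eta hd hρ hτ, Real.fourier_eq']
  rw [setIntegral_congr_fun measurableSet_Ioi h1, Real.fourier_eq', ← integral_integral_swap]
  · refine integral_congr_ae (ae_of_all _ fun x => ?_)
    simp only [fundamentalSolution]
    rw [integral_smul]
  · refine hInt.mono ?_ (ae_of_all _ fun z => ?_)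
    · refine AEStronglyMeasurable.smul (f := fun z : EuclideanSpace ℝ (Fin d) × ℝ =>
        Complex.exp (((-2 * Real.pi * inner ℝ z.1 ζ : ℝ) : ℂ) * Complex.I)) ?_ hInt.1
      exact Continuous.aestronglyMeasurable (by fun_prop)
    · simp only [Function.uncurry_def]
      rw [norm_smul, Complex.norm_exp_ofReal_mul_I, one_mul]

lemma norm_fourier_fundamentalSolution_le (hd : 0 < d) (hρ : 0 < ρ) (hkl : IsPC k ℓ) (ht : 0 < t)
    {ζ : EuclideanSpace ℝ (Fin d)} (hζ : ζ ≠ 0) :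
    ‖𝓕 (fundamentalSolution d ρ k t) ζ‖ ≤
      1 / (1 + (2 * Real.pi * ‖ζ‖) ^ ρ * timeConv (fun _ => 1) ℓ t) := by
  obtain ⟨hL, hle⟩ := hkl.lintegral_exp_propagationMeasure_le ht
  have hζ' : 0 < ‖ζ‖ := norm_pos_iff.2 hζ
  have hq : 0 < (2 * Real.pi * ‖ζ‖) ^ ρ := Real.rpow_pos_of_pos (by positivity) _
  rw [← ENNReal.ofReal_le_ofReal_iff (by positivity), ofReal_norm,
    fourier_fundamentalSolution hd hρ hkl.isKernel ht]
  refine (enorm_integral_le_lintegral_enorm _).trans (le_trans (le_of_eq ?_) (hle _ hq))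
  refine lintegral_congr fun τ => ?_
  rw [heatSymbol, ← ofReal_norm, Complex.norm_real, Real.norm_eq_abs, Real.abs_exp, mul_comm τ]

lemma mildSolution_eq_convolution :
    mildSolution d ρ k u₀ t =
      u₀ ⋆[ContinuousLinearMap.mul ℂ ℂ, volume] fundamentalSolution d ρ k t := by
  ext x
  rw [mildSolution, convolution_def]
  refine integral_congr_ae (ae_of_all _ fun y => ?_)
  simp only [ContinuousLinearMap.mul_apply']
  rw [mul_comm]

lemma fourier_mildSolution (hd : 0 < d) (hρ : 0 < ρ) (hk : IsKernel k) (ht : 0 < t)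
    (hu₁ : Integrable u₀) (ζ : EuclideanSpace ℝ (Fin d)) :
    𝓕 (mildSolution d ρ k u₀ t) ζ = 𝓕 u₀ ζ * 𝓕 (fundamentalSolution d ρ k t) ζ := by
  rw [mildSolution_eq_convolution]
  exact Real.fourier_mul_convolution_eq hu₁ (integrable_fundamentalSolution hd hρ hk ht) ζ

lemma integrable_mildSolution (hd : 0 < d) (hρ : 0 < ρ) (hk : IsKernel k) (ht : 0 < t)
    (hu₁ : Integrable u₀) : Integrable (mildSolution d ρ k u₀ t) := by
  rw [mildSolution_eq_convolution]
  exact hu₁.integrable_convolution _ (integrable_fundamentalSolution hd hρ hk ht)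

lemma norm_fourier_mildSolution_le (hd : 0 < d) (hρ : 0 < ρ) (hkl : IsPC k ℓ) (ht : 0 < t)
    (hu₁ : Integrable u₀) :
    ∀ᵐ ζ : EuclideanSpace ℝ (Fin d), ‖𝓕 (mildSolution d ρ k u₀ t) ζ‖ ≤
      ‖𝓕 u₀ ζ‖ * (1 / (1 + (2 * Real.pi * ‖ζ‖) ^ ρ * timeConv (fun _ => 1) ℓ t)) := by
  have : Nonempty (Fin d) := ⟨⟨0, hd⟩⟩
  filter_upwards [Measure.ae_ne volume (0 : EuclideanSpace ℝ (Fin d))] with ζ hζ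
  rw [fourier_mildSolution hd hρ hkl.isKernel ht hu₁, norm_mul]
  gcongr
  exact norm_fourier_fundamentalSolution_le hd hρ hkl ht hζ

/-- The relaxation factor is at most `1`, so the transform of the solution is dominated by `𝓕 u₀`,
which is in `L₂`. -/
lemma memLp_mildSolution (hd : 0 < d) (hρ : 0 < ρ) (hkl : IsPC k ℓ) (ht : 0 < t)
    (hu₁ : Integrable u₀) (hu₂ : MemLp u₀ 2 volume) :
    MemLp (mildSolution d ρ k u₀ t) 2 volume ∧
      eLpNorm (mildSolution d ρ k u₀ t) 2 volume =
        eLpNorm (𝓕 (mildSolution d ρ k u₀ t)) 2 volume := by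
  have hInt := integrable_mildSolution hd hρ hkl.isKernel ht hu₁
  refine memLp_of_fourier hInt ?_
  refine (memLp_fourier hu₁ hu₂).mono
    (continuous_fourier_of_integrable hInt).aestronglyMeasurable ?_
  filter_upwards [norm_fourier_mildSolution_le hd hρ hkl ht hu₁] with ζ hζ
  refine hζ.trans (mul_le_of_le_one_right (norm_nonneg _) ?_)
  have hL := (hkl.lintegral_exp_propagationMeasure_le ht).1
  have : 0 ≤ (2 * Real.pi * ‖ζ‖) ^ ρ := by positivity
  rw [div_le_one (by positivity)]
  nlinarith

/-- Decay in high dimensions, where the singularity of `‖ζ‖^{-2ρ}` is integrable. -/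
lemma exists_eLpNorm_mildSolution_le_of_lt (hd : 0 < d) (hρ : 0 < ρ) (hdρ : 2 * ρ < d)
    (hkl : IsPC k ℓ) (hu₁ : Integrable u₀) (hu₂ : MemLp u₀ 2 volume) :
    ∃ C : ℝ, 0 < C ∧ ∀ t : ℝ, 0 < t → eLpNorm (mildSolution d ρ k u₀ t) 2 volume ≤
      ENNReal.ofReal (C * timeConv (fun _ => 1) ℓ t ^ (-1 : ℝ)) := by
  have : Nonempty (Fin d) := ⟨⟨0, hd⟩⟩
  set M : ℝ := ∫ x, ‖u₀ x‖ with hM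
  let g : EuclideanSpace ℝ (Fin d) → ℝ := fun ζ => ‖𝓕 u₀ ζ‖ * ((2 * Real.pi * ‖ζ‖) ^ ρ)⁻¹
  have hg_meas : AEStronglyMeasurable g volume := by
    have h1 : Measurable fun ζ : EuclideanSpace ℝ (Fin d) => ‖𝓕 u₀ ζ‖ :=
      (continuous_fourier_of_integrable hu₁).measurable.norm
    exact (h1.mul (by fun_prop : Measurable fun ζ : EuclideanSpace ℝ (Fin d) =>
      ((2 * Real.pi * ‖ζ‖) ^ ρ)⁻¹)).aestronglyMeasurable
  have hg : MemLp g 2 volume := by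
    rw [memLp_two_iff_integrable_sq hg_meas]
    have hsing := integrable_indicator_norm_rpow (E := EuclideanSpace ℝ (Fin d)) (a := 2 * ρ)
      (by simpa using hdρ)
    have hsq := (memLp_two_iff_integrable_sq_norm
      (continuous_fourier_of_integrable hu₁).aestronglyMeasurable).1 (memLp_fourier hu₁ hu₂)
    refine ((hsing.const_mul (M ^ 2)).add hsq).mono' (hg_meas.pow 2) ?_
    filter_upwards [Measure.ae_ne volume (0 : EuclideanSpace ℝ (Fin d))] with ζ hζ
    have hζ' : 0 < ‖ζ‖ := norm_pos_iff.2 hζ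
    have hπ : 1 ≤ 2 * Real.pi := by linarith [Real.pi_gt_three]
    rw [Real.norm_eq_abs, abs_of_nonneg (sq_nonneg _)]
    simp only [g, Pi.add_apply, mul_pow]
    -- Inside the unit ball `‖𝓕 u₀‖ ≤ M` and `‖ζ‖^{-2ρ}` is integrable because `2ρ < d`; outside,
    -- the weight is at most `1` and Plancherel applies.
    by_cases h1 : ‖ζ‖ ≤ 1
    · rw [indicator_of_mem (mem_Iic.2 h1)]
      have h2 : (((2 * Real.pi * ‖ζ‖) ^ ρ)⁻¹) ^ 2 ≤ ‖ζ‖ ^ (-(2 * ρ)) := by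
        have h3 : ‖ζ‖ ^ (-(2 * ρ)) = ((‖ζ‖ ^ ρ)⁻¹) ^ 2 := by
          rw [← Real.rpow_neg hζ'.le, ← Real.rpow_natCast, ← Real.rpow_mul hζ'.le]
          congr 1
          push_cast
          ring
        rw [h3]
        gcongr
        nlinarith
      have h4 : ‖𝓕 u₀ ζ‖ ^ 2 ≤ M ^ 2 := by
        gcongr
        exact norm_fourier_le_integral u₀ ζ
      have h5 := mul_le_mul h4 h2 (by positivity) (by positivity)
      have h6 : 0 ≤ ‖𝓕 u₀ ζ‖ ^ 2 := by positivity
      linarith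
    · rw [indicator_of_notMem (notMem_Iic.2 (not_le.1 h1)), mul_zero, zero_add]
      refine mul_le_of_le_one_right (by positivity) (pow_le_one₀ (by positivity) ?_)
      refine inv_le_one_of_one_le₀ (Real.one_le_rpow ?_ hρ.le)
      nlinarith [not_le.1 h1]
  -- The summand `1` keeps the constant positive even when `u₀ = 0`.
  refine ⟨(eLpNorm g 2 volume).toReal + 1, by positivity, fun t ht => ?_⟩
  have hL := (hkl.lintegral_exp_propagationMeasure_le ht).1
  set L := timeConv (fun _ => 1) ℓ t with hL_def
  rw [(memLp_mildSolution hd hρ hkl ht hu₁ hu₂).2]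
  have hbound : ∀ᵐ ζ : EuclideanSpace ℝ (Fin d), ‖𝓕 (mildSolution d ρ k u₀ t) ζ‖ ≤ (L⁻¹ • g) ζ := by
    filter_upwards [norm_fourier_mildSolution_le hd hρ hkl ht hu₁,
      Measure.ae_ne volume (0 : EuclideanSpace ℝ (Fin d))] with ζ hζ h0
    refine hζ.trans ?_
    have hζ' : 0 < ‖ζ‖ := norm_pos_iff.2 h0
    have hq : 0 < (2 * Real.pi * ‖ζ‖) ^ ρ := Real.rpow_pos_of_pos (by positivity) _
    simp only [g, Pi.smul_apply, smul_eq_mul]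
    rw [mul_left_comm, ← mul_inv, ← one_div]
    gcongr
    rw [mul_comm L]
    linarith
  refine (eLpNorm_mono_ae_real hbound).trans ?_
  rw [eLpNorm_const_smul, Real.rpow_neg_one, mul_comm, ENNReal.ofReal_mul (by positivity),
    Real.enorm_eq_ofReal (by positivity)]
  gcongr
  rw [← ENNReal.ofReal_toReal hg.2.ne, ENNReal.toReal_ofReal ENNReal.toReal_nonneg]
  exact ENNReal.ofReal_le_ofReal (by linarith)

/-- Decay in low dimensions, by scaling. -/
lemma exists_eLpNorm_mildSolution_le_of_gt (hd : 0 < d) (hρ : 0 < ρ) (hdρ : d < 2 * ρ)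
    (hkl : IsPC k ℓ) (hu₁ : Integrable u₀) (hu₂ : MemLp u₀ 2 volume) :
    ∃ C : ℝ, 0 < C ∧ ∀ t : ℝ, 0 < t → eLpNorm (mildSolution d ρ k u₀ t) 2 volume ≤
      ENNReal.ofReal (C * timeConv (fun _ => 1) ℓ t ^ (-((d : ℝ) / (2 * ρ)))) := by
  have : Nonempty (Fin d) := ⟨⟨0, hd⟩⟩
  set M : ℝ := ∫ x, ‖u₀ x‖ with hM
  have hM0 : 0 ≤ M := integral_nonneg fun _ => norm_nonneg _
  let H : EuclideanSpace ℝ (Fin d) → ℝ := fun ζ => 1 / (1 + (2 * Real.pi * ‖ζ‖) ^ ρ)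
  have hH : Integrable fun ζ => H ζ ^ 2 :=
    integrable_inv_one_add_norm_rpow_sq (E := EuclideanSpace ℝ (Fin d)) (by positivity)
      (by simpa using hdρ)
  have hH0 : ∀ ζ, 0 ≤ H ζ := fun ζ => by positivity
  have hHm : Measurable H := by fun_prop
  set B : ℝ := ∫ ζ, H ζ ^ 2 with hB
  have hB0 : 0 ≤ B := integral_nonneg fun _ => sq_nonneg _
  refine ⟨M * B ^ ((1 : ℝ) / 2) + 1, by positivity, fun t ht => ?_⟩
  have hL := (hkl.lintegral_exp_propagationMeasure_le ht).1
  set L := timeConv (fun _ => 1) ℓ t with hL_def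
  rw [(memLp_mildSolution hd hρ hkl ht hu₁ hu₂).2]
  -- Chosen so that `c^ρ = L`: the relaxation factor becomes `H (c • ζ)`, whose `L₂` norm is
  -- `c^{-d/2} = L^{-d/(2ρ)}` times that of `H`.
  set c : ℝ := L ^ (1 / ρ) with hc
  have hc0 : 0 < c := Real.rpow_pos_of_pos hL _
  have hcρ : c ^ ρ = L := by
    rw [hc, ← Real.rpow_mul hL.le, one_div, inv_mul_cancel₀ hρ.ne', Real.rpow_one]
  have hbound : ∀ᵐ ζ : EuclideanSpace ℝ (Fin d), ‖𝓕 (mildSolution d ρ k u₀ t) ζ‖ ≤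
      (M • fun ζ => H (c • ζ)) ζ := by
    filter_upwards [norm_fourier_mildSolution_le hd hρ hkl ht hu₁] with ζ hζ
    refine hζ.trans ?_
    simp only [H, Pi.smul_apply, smul_eq_mul]
    rw [norm_smul, Real.norm_of_nonneg hc0.le, mul_left_comm,
      Real.mul_rpow hc0.le (by positivity), hcρ, mul_comm L]
    gcongr
    exact norm_fourier_le_integral u₀ ζ
  refine (eLpNorm_mono_ae_real hbound).trans ?_
  have hmem : MemLp (fun ζ : EuclideanSpace ℝ (Fin d) => H (c • ζ)) 2 volume := by
    refine (memLp_two_iff_integrable_sq ?_).2 (hH.comp_smul hc0.ne')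
    exact (hHm.comp (measurable_const_smul c)).aestronglyMeasurable
  have hnorm : eLpNorm (fun ζ : EuclideanSpace ℝ (Fin d) => H (c • ζ)) 2 volume =
      ENNReal.ofReal (B ^ ((1 : ℝ) / 2) * L ^ (-((d : ℝ) / (2 * ρ)))) := by
    rw [hmem.eLpNorm_eq_integral_rpow_norm two_ne_zero ENNReal.ofNat_ne_top]
    congr 1
    have h1 : ∀ ζ : EuclideanSpace ℝ (Fin d), ‖H (c • ζ)‖ ^ (2 : ℝ≥0∞).toReal =
        H (c • ζ) ^ 2 := fun ζ => by
      rw [Real.norm_of_nonneg (hH0 _)]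
      simp
    simp only [h1]
    rw [Measure.integral_comp_smul volume (fun ζ : EuclideanSpace ℝ (Fin d) => H ζ ^ 2) c,
      finrank_euclideanSpace_fin,
      smul_eq_mul, ← hB, abs_of_nonneg (by positivity), mul_comm,
      Real.mul_rpow hB0 (by positivity)]
    simp only [ENNReal.toReal_ofNat, one_div]
    congr 1
    rw [← Real.rpow_natCast, ← Real.rpow_neg hc0.le, ← Real.rpow_mul hc0.le, hc,
      ← Real.rpow_mul hL.le]
    congr 1
    field_simp
  rw [eLpNorm_const_smul, hnorm, Real.enorm_eq_ofReal hM0, ← ENNReal.ofReal_mul hM0, ← mul_assoc]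
  refine ENNReal.ofReal_le_ofReal ?_
  gcongr
  linarith

end solution

end NonlocalDiffusion

end

open MeasureTheory Set NonlocalDiffusion in
theorem mainTheorem5 (d : ℕ) (hd : 0 < d) (ρ : ℝ) (hρ : 0 < ρ) (hdρ : (d : ℝ) ≠ 2 * ρ)
    (k ℓ : ℝ → ℝ) (hkl : IsPC k ℓ)
    (u₀ : EuclideanSpace ℝ (Fin d) → ℂ) (hu₁ : Integrable u₀ volume) (hu₂ : MemLp u₀ 2 volume) :
    -- the integrals that define `Z(t, ·)` and `u(t, ·)` converge almost everywhere
    (∀ t : ℝ, 0 < t →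
      (∀ᵐ x : EuclideanSpace ℝ (Fin d),
        IntegrableOn (fun τ => eta d ρ τ x) (Ioi 0) (propagationMeasure k t)) ∧
      (∀ᵐ x : EuclideanSpace ℝ (Fin d),
        Integrable (fun y => fundamentalSolution d ρ k t (x - y) * u₀ y) volume) ∧
      MemLp (mildSolution d ρ k u₀ t) 2 volume) ∧
    -- the decay estimate
    ∃ C : ℝ, 0 < C ∧ ∀ t : ℝ, 1 < t →
      eLpNorm (mildSolution d ρ k u₀ t) 2 volume ≤
        ENNReal.ofReal (C * timeConv (fun _ => 1) ℓ t ^ (-(min 1 ((d : ℝ) / (2 * ρ))))) := by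
  refine ⟨fun t ht => ⟨?_, ?_, (memLp_mildSolution hd hρ hkl ht hu₁ hu₂).1⟩, ?_⟩
  · have := isFiniteMeasure_propagationMeasure hkl.isKernel ht
    exact (integrable_eta_prod hd hρ (propagationMeasure k t)).prod_right_ae
  · have h := hu₁.ae_convolution_exists (ContinuousLinearMap.mul ℂ ℂ)
      (integrable_fundamentalSolution hd hρ hkl.isKernel ht)
    filter_upwards [h] with x hx
    refine hx.integrable.congr (Filter.Eventually.of_forall fun y => ?_)
    simp only [ContinuousLinearMap.mul_apply']
    rw [mul_comm]
  · rcases lt_or_gt_of_ne hdρ with h | h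
    · rw [min_eq_right (by rw [div_le_one (by positivity)]; exact h.le)]
      obtain ⟨C, hC, hle⟩ := exists_eLpNorm_mildSolution_le_of_gt hd hρ h hkl hu₁ hu₂
      exact ⟨C, hC, fun t ht => hle t (one_pos.trans ht)⟩
    · rw [min_eq_left (by rw [one_le_div (by positivity)]; exact h.le)]
      obtain ⟨C, hC, hle⟩ := exists_eLpNorm_mildSolution_le_of_lt hd hρ h hkl hu₁ hu₂
      exact ⟨C, hC, fun t ht => hle t (one_pos.trans ht)⟩
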